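/- **Setting.** Let $\mathcal T$ be a finite triangulated surface, possibly with boundary, with vertex set $V$, edge set $E$ and triangle set $T$: a surface obtained from finitely many triangles by gluing some of their sides in pairs. (Neither regularity nor orientability is required; in the notation below, $ijk$ denotes a triangle with corners at $i,j,k$, and if a vertex or an edge occurs several times in one triangle, each occurrence is counted separately.) Let $\theta:E\to[0,\pi)$ and $\Xi:V\to(0,\infty)$. **Coherent angle systems.** Let $\Delta\subset\mathbb R^6$ be the set of $(\alpha_{12},\alpha_{23},\alpha_{31},\gamma_1,\gamma_2,\gamma_3)$ with all entries positive, $\gamma_1+\gamma_2+\gamma_3=\pi$, and $$\gamma_1+\alpha_{12}+\alpha_{31}<\pi,\qquad \gamma_2+\alpha_{23}+\alpha_{12}<\pi,\qquad \gamma_3+\alpha_{31}+\alpha_{23}<\pi .$$ Label the coordinates of $\mathbb R^{6|T|}$ by $\alpha^t_{ij}$ (one for each side $ij$ of each triangle $t$) and $\gamma^t_i$ (one for each corner $i$ of each triangle $t$). $\mathcal A(\mathcal T,\theta,\Xi)$ is the set of all $(\alpha,\gamma)\in\mathbb R^{6|T|}$ such that * $(\alpha^t_{ij},\alpha^t_{jk},\alpha^t_{ki},\gamma^t_i,\gamma^t_j,\gamma^t_k)\in\Delta$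 for each triangle $t=ijk$; * $\alpha^t_{ij}+\alpha^{t'}_{ji}=\pi-\theta_{ij}$ for each interior edge $ij$, with adjacent triangles $t,t'$; * $\theta_{ij}>0$ and $\alpha^t_{ij}=\pi-\theta_{ij}$ for each boundary edge $ij$, with adjacent triangle $t$; * $\sum_{t\ni i}\gamma^t_i=\Xi_i$ for each vertex $i$. **Functional.** Let $L(x)=-\int_0^x\log|2\sin\xi|\,d\xi$ and $F=\sum_{t=ijk\in T}V(\alpha^t_{ij},\alpha^t_{jk},\alpha^t_{ki},\gamma^t_i,\gamma^t_j,\gamma^t_k)$, where $$2V(\alpha_{12},\alpha_{23},\alpha_{31},\gamma_1,\gamma_2,\gamma_3)=\sum_{(i,j,k)}\Big[L(\gamma_i)+L\big(\tfrac{\pi+\alpha_{ki}-\alpha_{ij}-\gamma_i}{2}\big)+L\big(\tfrac{\pi-\alpha_{ki}+\alpha_{ij}-\gamma_i}{2}\big)+L\big(\tfrac{\pi+\alpha_{ki}+\alpha_{ij}-\gamma_i}{2}\big)+L\big(\tfrac{\pi-\alpha_{ki}-\alpha_{ij}-\gamma_i}{2}\big)\Big],$$ the sum being over the cyclic permutations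 $(i,j,k)$ of $(1,2,3)$. A point $p\in\mathcal A(\mathcal T,\theta,\Xi)$ is a *critical point of $F$ under variations in $\mathcal A(\mathcal T,\theta,\Xi)$* if the derivative of $F$ at $p$ vanishes along every curve in $\mathcal A(\mathcal T,\theta,\Xi)$ through $p$ that is differentiable at $p$. **Circle patterns.** A *decorated triangle* is a euclidean triangle together with three circles centered at its vertices that neither touch nor intersect (the sum of the radii at two vertices is less than the length of the side between them), and a fourth circle, the face-circle, that intersects these three orthogonally. Its angles are the interior angles $\gamma_i$ of the triangle and, for each side $ij$, the angle $\alpha_{ij}$ between the side and the face-circle, measured inside the triangle and outside the face-circle. A *euclidean hyperideal circle pattern* with triangulation $\mathcal T$ consists of lengths $l:E\to(0,\infty)$ satisfying the strict triangle inequalities in each triangle, and radii $r:V\to(0,\infty)$, such that * (i) $r_i+r_j<l_{ij}$ for each edge $ij$; * (ii) for each interior edge $ij$ with adjacent triangles $ijk$ and $jil$, drawn abutting in the plane with circles of the given radii around the vertices, the face-circle of one triangle does not intersect the fourth vertex-circle more than orthogonally, that is, $\delta^2\ge R^2+\rho^2$, where $R,\rho$ are the radii of these two circles and $\delta$ is the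 distance of their centers. The decorated triangles determined by $p=(\alpha,\gamma)\in\mathcal A(\mathcal T,\theta,\Xi)$ *fit together* if there is a euclidean hyperideal circle pattern with triangulation $\mathcal T$ in which, for every triangle $t=ijk$, the decorated triangle with side lengths $l_{ij},l_{jk},l_{ki}$ and vertex radii $r_i,r_j,r_k$ has the angles $\alpha^t_{ij},\alpha^t_{jk},\alpha^t_{ki},\gamma^t_i,\gamma^t_j,\gamma^t_k$. **Lemma 3.1.** A coherent angle system $p\in\mathcal A(\mathcal T,\theta,\Xi)$ is a critical point of $F$ under variations in $\mathcal A(\mathcal T,\theta,\Xi)$ if and only if the decorated triangles determined by $p$ fit together. -/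

import Mathlib

open Real Filter Topology

/-- The euclidean plane. -/
abbrev Plane : Type := EuclideanSpace ℝ (Fin 2)

/-- A (compact) triangulated surface, possibly with boundary, presented by a family of triangles
indexed by `T`, whose sides are glued in pairs.

Each triangle has corners `0, 1, 2`, and its side `k` is the one opposite to corner `k`.
A directed side is a pair `d = (t, s)` with `s` a permutation of the corners: the side of `t`
running from corner `s 0` to corner `s 1`, opposite to corner `s 2`.  If `glue d = d'` with
`d' ≠ d`, the two directed sides are identified (start with start, end with end); if `glue d = d`,
the side is a boundary edge.  The triangulation need be neither regular nor orientable. -/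
structure Triangulation (T : Type*) where
  glue : T × Equiv.Perm (Fin 3) → T × Equiv.Perm (Fin 3)
  glue_glue : ∀ d, glue (glue d) = d
  /-- Gluing is compatible with reversing the direction of a side. -/
  glue_reverse : ∀ d, glue (d.1, d.2 * Equiv.swap 0 1)
    = ((glue d).1, (glue d).2 * Equiv.swap 0 1)
  /-- No side is folded onto itself. -/
  glue_ne_reverse : ∀ d, glue d ≠ (d.1, d.2 * Equiv.swap 0 1)

namespace Triangulation

variable {T : Type*} (𝒯 : Triangulation T)

/-- The vertices: corners of triangles, up to the identifications generated by the gluing. -/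
def Vertex : Type _ :=
  Quot (fun c c' : T × Fin 3 =>
    ∃ d, c = (d.1, d.2 0) ∧ c' = ((𝒯.glue d).1, (𝒯.glue d).2 0))

/-- The edges: sides of triangles, up to the gluing. -/
def Edge : Type _ :=
  Quot (fun s s' : T × Fin 3 =>
    ∃ d, s = (d.1, d.2 2) ∧ s' = ((𝒯.glue d).1, (𝒯.glue d).2 2))

/-- The vertex at corner `k` of triangle `t`. -/
def vertex (t : T) (k : Fin 3) : 𝒯.Vertex := Quot.mk _ (t, k)

/-- The edge at the side of triangle `t` opposite to corner `k`. -/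
def edge (t : T) (k : Fin 3) : 𝒯.Edge := Quot.mk _ (t, k)

end Triangulation

/-- The space `ℝ^{6|T|}` of pairs `(α, γ)`: `α t k` is the angle belonging to the side of `t`
opposite to corner `k`, and `γ t k` is the angle belonging to corner `k`. -/
abbrev AngleSpace (T : Type*) : Type _ := (T → Fin 3 → ℝ) × (T → Fin 3 → ℝ)

/-- The set `Δ` of possible angles of one decorated triangle. The sides that meet at corner `k`
are the sides `k + 1` and `k + 2`. -/
structure IsTriangleAngles (a g : Fin 3 → ℝ) : Prop where
  side_pos : ∀ k, 0 < a k
  corner_pos : ∀ k, 0 < g k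
  corner_sum : g 0 + g 1 + g 2 = π
  lt_pi : ∀ k, g k + a (k + 1) + a (k + 2) < π

open Classical in
/-- The set `𝒜(𝒯, θ, Ξ)` of coherent angle systems. -/
structure IsCoherent {T : Type*} [Fintype T] (𝒯 : Triangulation T)
    (θ : 𝒯.Edge → ℝ) (Ξ : 𝒯.Vertex → ℝ) (p : AngleSpace T) : Prop where
  triangle : ∀ t, IsTriangleAngles (p.1 t) (p.2 t)
  interior : ∀ d, 𝒯.glue d ≠ d →
    p.1 d.1 (d.2 2) + p.1 (𝒯.glue d).1 ((𝒯.glue d).2 2) = π - θ (𝒯.edge d.1 (d.2 2))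
  boundary : ∀ d, 𝒯.glue d = d →
    0 < θ (𝒯.edge d.1 (d.2 2)) ∧ p.1 d.1 (d.2 2) = π - θ (𝒯.edge d.1 (d.2 2))
  vertex_sum : ∀ v,
    (∑ c : T × Fin 3, if 𝒯.vertex c.1 c.2 = v then p.2 c.1 c.2 else 0) = Ξ v

/-- The set of coherent angle systems, as a subset of `ℝ^{6|T|}`. -/
def coherentAngleSystems {T : Type*} [Fintype T] (𝒯 : Triangulation T)
    (θ : 𝒯.Edge → ℝ) (Ξ : 𝒯.Vertex → ℝ) : Set (AngleSpace T) :=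
  {p | IsCoherent 𝒯 θ Ξ p}

/-- Milnor's Lobachevsky function. -/
noncomputable def lobachevsky (x : ℝ) : ℝ := -∫ ξ in (0 : ℝ)..x, log |2 * sin ξ|

/-- The function `V` of the six angles of a decorated triangle. -/
noncomputable def triangleV (a g : Fin 3 → ℝ) : ℝ :=
  (1 / 2) * ∑ k : Fin 3,
    (lobachevsky (g k)
      + lobachevsky ((π + a (k + 1) - a (k + 2) - g k) / 2)
      + lobachevsky ((π - a (k + 1) + a (k + 2) - g k) / 2)
      + lobachevsky ((π + a (k + 1) + a (k + 2) - g k) / 2)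
      + lobachevsky ((π - a (k + 1) - a (k + 2) - g k) / 2))

/-- The functional `F = ∑ V`, the sum over all triangles. -/
noncomputable def functionalF {T : Type*} [Fintype T] (p : AngleSpace T) : ℝ :=
  ∑ t, triangleV (p.1 t) (p.2 t)

/-- `p` is a critical point of `F` under variations in `A`: the derivative of `F` vanishes along
every curve `c` in `A` with `c 0 = p` that is differentiable at `0`. -/
def IsCriticalUnderVariationsIn {X : Type*} [NormedAddCommGroup X] [NormedSpace ℝ X]
    (F : X → ℝ) (A : Set X) (p : X) : Prop :=
  p ∈ A ∧ ∀ c : ℝ → X, c 0 = p → DifferentiableAt ℝ c 0 → (∀ᶠ s in 𝓝 0, c s ∈ A) →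
    HasDerivAt (fun s => F (c s)) 0 0

/-- A decorated triangle: a euclidean triangle with three circles around its vertices that do not
touch or intersect, and a fourth circle (the face-circle) orthogonal to these three.
Circles with centers at distance `δ` and radii `ρ, ρ'` are orthogonal iff `δ² = ρ² + ρ'²`. -/
structure DecoratedTriangle where
  pt : Fin 3 → Plane
  rad : Fin 3 → ℝ
  faceCenter : Plane
  faceRad : ℝ
  affineIndependent : AffineIndependent ℝ pt
  rad_pos : ∀ k, 0 < rad k
  faceRad_pos : 0 < faceRad
  disjoint : ∀ i j, i ≠ j → rad i + rad j < dist (pt i) (pt j)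
  orthogonal : ∀ k, dist faceCenter (pt k) ^ 2 = faceRad ^ 2 + rad k ^ 2

namespace DecoratedTriangle

/-- `a` is the angle in which the face-circle intersects the side opposite to corner `k`, measured
inside the triangle and outside the face-circle.  At a point `P` of intersection, the region
inside the triangle and outside the face-circle is a wedge with inner normals `n` (pointing to the
side of corner `k`) and `P - faceCenter`, so its angle is the angle between `n` and
`faceCenter - P`. -/
def IsSideAngle (D : DecoratedTriangle) (k : Fin 3) (a : ℝ) : Prop :=
  ∃ P n : Plane, P ∈ line[ℝ, D.pt (k + 1), D.pt (k + 2)] ∧ dist P D.faceCenter = D.faceRad ∧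
    inner ℝ n (D.pt (k + 2) - D.pt (k + 1)) = 0 ∧ 0 < inner ℝ n (D.pt k - D.pt (k + 1)) ∧
    InnerProductGeometry.angle n (D.faceCenter - P) = a

/-- The decorated triangle has angles `a` (at the sides) and `g` (at the corners). -/
def HasAngles (D : DecoratedTriangle) (a g : Fin 3 → ℝ) : Prop :=
  ∀ k, D.IsSideAngle k (a k) ∧
    EuclideanGeometry.angle (D.pt (k + 1)) (D.pt k) (D.pt (k + 2)) = g k

/-- The side lengths and the radii of the vertex-circles of `D` are those that the edge
lengths `l` and radii `r` prescribe for the triangle `t` of `𝒯`. -/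
def IsDrawing {T : Type*} (D : DecoratedTriangle) (𝒯 : Triangulation T)
    (l : 𝒯.Edge → ℝ) (r : 𝒯.Vertex → ℝ) (t : T) : Prop :=
  ∀ k, dist (D.pt (k + 1)) (D.pt (k + 2)) = l (𝒯.edge t k) ∧ D.rad k = r (𝒯.vertex t k)

end DecoratedTriangle

/-- A euclidean hyperideal circle pattern with triangulation `𝒯`: a piecewise flat metric given by
edge lengths `l`, together with radii `r` of circles at the vertices. -/
structure IsHyperidealCirclePattern {T : Type*} (𝒯 : Triangulation T)
    (l : 𝒯.Edge → ℝ) (r : 𝒯.Vertex → ℝ) : Prop where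
  length_pos : ∀ e, 0 < l e
  triangle_lt : ∀ t k, l (𝒯.edge t k) < l (𝒯.edge t (k + 1)) + l (𝒯.edge t (k + 2))
  rad_pos : ∀ v, 0 < r v
  /-- Vertex-circles joined by an edge do not touch or intersect. -/
  disjoint : ∀ t k, r (𝒯.vertex t (k + 1)) + r (𝒯.vertex t (k + 2)) < l (𝒯.edge t k)
  /-- The local Delaunay condition: if the triangles on both sides of an interior edge are drawn
  abutting in the plane, with `x` the remaining vertex of the second one, then the face-circle of
  the first one does not intersect the vertex-circle around `x` more than orthogonally. -/
  delaunay : ∀ d, 𝒯.glue d ≠ d → ∀ D : DecoratedTriangle, D.IsDrawing 𝒯 l r d.1 → ∀ x : Plane,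
    dist (D.pt (d.2 0)) x = l (𝒯.edge (𝒯.glue d).1 ((𝒯.glue d).2 1)) →
    dist (D.pt (d.2 1)) x = l (𝒯.edge (𝒯.glue d).1 ((𝒯.glue d).2 0)) →
    (line[ℝ, D.pt (d.2 0), D.pt (d.2 1)]).SOppSide (D.pt (d.2 2)) x →
    D.faceRad ^ 2 + r (𝒯.vertex (𝒯.glue d).1 ((𝒯.glue d).2 2)) ^ 2 ≤ dist D.faceCenter x ^ 2

/-- The decorated triangles determined by the angles `p` fit together: there is a hyperideal circle
pattern with triangulation `𝒯` each of whose decorated triangles has the angles given by `p`. -/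
def DecoratedTrianglesFit {T : Type*} (𝒯 : Triangulation T) (p : AngleSpace T) : Prop :=
  ∃ (l : 𝒯.Edge → ℝ) (r : 𝒯.Vertex → ℝ), IsHyperidealCirclePattern 𝒯 l r ∧
    ∀ t, ∃ D : DecoratedTriangle, D.IsDrawing 𝒯 l r t ∧ D.HasAngles (p.1 t) (p.2 t)

/-!
The derivative of `functionalF` is the Schläfli formula for the hyperideal tetrahedra, with one ideal
vertex at infinity, that stand over the decorated triangles. For a decorated triangle with face-circle
of radius `R` and vertex-circles of radii `r k`, the partial derivative of `2 V` with respect to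
the angle at the corner `k` is `log (r k / R)`, and the one with respect to the angle at a side is
`-λ`, where `λ > 0` is given by `l² = r² + r'² + 2 r r' cosh λ` with `l` the length of the side and
`r, r'` the radii at its ends (`hasDerivAt_triangleV`, `DecoratedTriangle.HasAngles.rad_eq`,
`DecoratedTriangle.HasAngles.dist_sq_eq`).

The coherent angle systems form a relatively open subset of an affine subspace, so that `p` is
critical iff the derivative of `F` is a combination of the linear constraints. For the sides, this
means that the two values of `λ` at an interior edge agree; for the corners, that the partial
derivatives have the form `μ t + ψ i` with one multiplier for each triangle `t` and one for each
vertex `i`. If the triangles fit together, `μ = -log R` and `ψ = log r` are such multipliers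
(`variationF_eq_zero_of_fit`). Conversely, given multipliers, draw each triangle with the given
angles so that its face-circle has radius `exp (-μ)` (`exists_decoratedTriangle`). The radii of its
vertex-circles are then `exp ψ`, which depends on the vertex only, and the formula for `l` shows that
the side lengths agree along the edges (`fit_of_multipliers`).

The local Delaunay condition at an edge says that the angles `α, α'` of the two face-circles with it
satisfy `α + α' ≤ π` (`delaunay_of_add_le_pi`), which is `0 ≤ θ`.
-/

open scoped RealInnerProductSpace

/-! ### Arithmetic of corners modulo three -/

lemma fin3_add_one_add_one (k : Fin 3) : k + 1 + 1 = k + 2 := by revert k; decide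

lemma fin3_add_one_add_two (k : Fin 3) : k + 1 + 2 = k := by revert k; decide

lemma fin3_add_two_add_one (k : Fin 3) : k + 2 + 1 = k := by revert k; decide

lemma fin3_add_two_add_two (k : Fin 3) : k + 2 + 2 = k + 1 := by revert k; decide

/-! ### The Lobachevsky function -/

lemma hasDerivAt_lobachevsky {x : ℝ} (h0 : 0 < x) (h1 : x < π) :
    HasDerivAt lobachevsky (-(log 2 + log (sin x))) x := by
  have hs : 0 < sin x := sin_pos_of_pos_of_lt_pi h0 h1
  have hI : IntervalIntegrable (fun ξ => log |2 * sin ξ|) MeasureTheory.volume 0 x := by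
    have : MeromorphicOn (fun ξ : ℝ => 2 * sin ξ) (Set.uIcc 0 x) := fun y _ =>
      (analyticAt_const.mul analyticAt_sin).meromorphicAt
    simpa using this.intervalIntegrable_log_norm
  have hm : Measurable fun ξ : ℝ => log |2 * sin ξ| := by fun_prop
  have hd := intervalIntegral.integral_hasDerivAt_right hI
    hm.stronglyMeasurable.stronglyMeasurableAtFilter
    (ContinuousAt.log (by fun_prop) (by positivity))
  have e : log |2 * sin x| = log 2 + log (sin x) := by
    rw [abs_of_pos (by positivity), log_mul two_ne_zero hs.ne']
  rw [e] at hd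
  exact hd.neg

/-! ### One corner of a decorated triangle -/

/-- In a decorated triangle with face-circle of radius `1`, the distance from a corner with angle
`g` to the foot of the perpendicular from the center of the face-circle to an adjacent side, where
`x` is the angle at this side and `y` the angle at the other adjacent side. -/
noncomputable def footDist (x y g : ℝ) : ℝ := (cos y + cos x * cos g) / sin g

/-- The radius of the vertex-circle at a corner with angle `g`, adjacent to sides with angles `x`
and `y`, if the face-circle has radius `1`. -/
noncomputable def cornerRad (x y g : ℝ) : ℝ := √(footDist x y g ^ 2 - sin x ^ 2)

/-- In the upper half-space model, the half-sphere over the face-circle meets the vertical plane over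
the side with angle `x` in a geodesic. This is the hyperbolic distance, along this geodesic, from its
highest point to the half-sphere over the vertex-circle at the corner with angle `g`. -/
noncomputable def cornerTau (x y g : ℝ) : ℝ := log ((footDist x y g + sin x) / cornerRad x y g)

lemma footDist_sq_sub {g : ℝ} (hg : sin g ≠ 0) (x y : ℝ) :
    footDist x y g ^ 2 - sin x ^ 2
      = (cos x ^ 2 + cos y ^ 2 + 2 * cos x * cos y * cos g) / sin g ^ 2 - 1 := by
  have h := sin_sq_add_cos_sq x
  have h' := sin_sq_add_cos_sq g
  unfold footDist
  field_simp
  rw [← sub_eq_zero] at h h' ⊢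
  linear_combination cos x ^ 2 * h' - sin g ^ 2 * h

lemma cornerRad_comm {g : ℝ} (hg : sin g ≠ 0) (x y : ℝ) :
    cornerRad x y g = cornerRad y x g := by
  unfold cornerRad
  rw [footDist_sq_sub hg, footDist_sq_sub hg]
  congr 1; ring

section Corner

variable {x y g : ℝ}

lemma sin_lt_footDist (hx : 0 < x) (hy : 0 < y) (hg : 0 < g) (h : g + x + y < π) :
    sin x < footDist x y g := by
  have hs : 0 < sin g := sin_pos_of_pos_of_lt_pi hg (by linarith)
  have : cos (π - (g + x)) < cos y := cos_lt_cos_of_nonneg_of_le_pi hy.le (by linarith) (by linarith)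
  rw [cos_pi_sub, cos_add] at this
  rw [footDist, lt_div_iff₀ hs]
  linarith

lemma cornerRad_pos (hx : 0 < x) (hy : 0 < y) (hg : 0 < g) (h : g + x + y < π) :
    0 < cornerRad x y g := by
  have := sin_lt_footDist hx hy hg h
  have hs : 0 < sin x := sin_pos_of_pos_of_lt_pi hx (by linarith)
  exact sqrt_pos.2 (by nlinarith)

lemma cornerRad_sq (hx : 0 < x) (hy : 0 < y) (hg : 0 < g) (h : g + x + y < π) :
    cornerRad x y g ^ 2 = footDist x y g ^ 2 - sin x ^ 2 := by
  have := sin_lt_footDist hx hy hg h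
  have hs : 0 < sin x := sin_pos_of_pos_of_lt_pi hx (by linarith)
  exact sq_sqrt (by nlinarith)

lemma exp_cornerTau (hx : 0 < x) (hy : 0 < y) (hg : 0 < g) (h : g + x + y < π) :
    exp (cornerTau x y g) = (footDist x y g + sin x) / cornerRad x y g := by
  have := sin_lt_footDist hx hy hg h
  have hs : 0 < sin x := sin_pos_of_pos_of_lt_pi hx (by linarith)
  have := cornerRad_pos hx hy hg h
  exact exp_log (div_pos (by linarith) this)

lemma exp_neg_cornerTau (hx : 0 < x) (hy : 0 < y) (hg : 0 < g) (h : g + x + y < π) :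
    exp (-cornerTau x y g) = (footDist x y g - sin x) / cornerRad x y g := by
  have := sin_lt_footDist hx hy hg h
  have hs : 0 < sin x := sin_pos_of_pos_of_lt_pi hx (by linarith)
  have hr := cornerRad_pos hx hy hg h
  rw [exp_neg, exp_cornerTau hx hy hg h, inv_div, div_eq_div_iff (by linarith) hr.ne']
  linear_combination cornerRad_sq hx hy hg h

lemma cornerRad_mul_cosh (hx : 0 < x) (hy : 0 < y) (hg : 0 < g) (h : g + x + y < π) :
    cornerRad x y g * cosh (cornerTau x y g) = footDist x y g := by
  have hr := cornerRad_pos hx hy hg h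
  rw [cosh_eq, exp_cornerTau hx hy hg h, exp_neg_cornerTau hx hy hg h]
  field_simp; ring

lemma cornerRad_mul_sinh (hx : 0 < x) (hy : 0 < y) (hg : 0 < g) (h : g + x + y < π) :
    cornerRad x y g * sinh (cornerTau x y g) = sin x := by
  have hr := cornerRad_pos hx hy hg h
  rw [sinh_eq, exp_cornerTau hx hy hg h, exp_neg_cornerTau hx hy hg h]
  field_simp; ring

lemma cornerTau_pos (hx : 0 < x) (hy : 0 < y) (hg : 0 < g) (h : g + x + y < π) :
    0 < cornerTau x y g := by
  have hs : 0 < sin x := sin_pos_of_pos_of_lt_pi hx (by linarith)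
  have hr := cornerRad_pos hx hy hg h
  have := cornerRad_mul_sinh hx hy hg h
  rw [← sinh_pos_iff]
  by_contra hn
  nlinarith

lemma footDist_add_sin (hg : sin g ≠ 0) :
    footDist x y g + sin x
      = 2 * sin ((π + x - y - g) / 2) * sin ((π + x + y - g) / 2) / sin g := by
  have e1 : sin ((π + x - y - g) / 2) = cos ((y + (g - x)) / 2) := by
    rw [← sin_pi_div_two_sub]; congr 1; ring
  have e2 : sin ((π + x + y - g) / 2) = cos ((y - (g - x)) / 2) := by
    rw [← sin_pi_div_two_sub, ← sin_pi_sub]; congr 1; ring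
  rw [e1, e2, ← cos_add_cos, cos_sub, footDist]
  field_simp; ring

lemma footDist_sub_sin (hg : sin g ≠ 0) :
    footDist x y g - sin x
      = 2 * sin ((π - x + y - g) / 2) * sin ((π - x - y - g) / 2) / sin g := by
  have e1 : sin ((π - x + y - g) / 2) = cos ((y - (g + x)) / 2) := by
    rw [← sin_pi_div_two_sub, ← sin_pi_sub]; congr 1; ring
  have e2 : sin ((π - x - y - g) / 2) = cos ((y + (g + x)) / 2) := by
    rw [← sin_pi_div_two_sub]; congr 1; ring
  rw [e1, e2, mul_right_comm, ← cos_add_cos, cos_add, footDist]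
  field_simp; ring

lemma log_cornerRad (hx : 0 < x) (hy : 0 < y) (hg : 0 < g) (h : g + x + y < π) :
    log (cornerRad x y g) = (log (footDist x y g + sin x) + log (footDist x y g - sin x)) / 2 := by
  have := sin_lt_footDist hx hy hg h
  have hs : 0 < sin x := sin_pos_of_pos_of_lt_pi hx (by linarith)
  rw [cornerRad, log_sqrt (by nlinarith), ← log_mul (by linarith) (by linarith)]
  congr 2; ring

lemma cornerTau_eq (hx : 0 < x) (hy : 0 < y) (hg : 0 < g) (h : g + x + y < π) :
    cornerTau x y g = (log (footDist x y g + sin x) - log (footDist x y g - sin x)) / 2 := by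
  have := sin_lt_footDist hx hy hg h
  have hs : 0 < sin x := sin_pos_of_pos_of_lt_pi hx (by linarith)
  have hr := cornerRad_pos hx hy hg h
  rw [cornerTau, log_div (by linarith) hr.ne', log_cornerRad hx hy hg h]
  ring

end Corner

/-- The contribution of one corner to `2 V`. -/
noncomputable def cornerW (x y g : ℝ) : ℝ :=
  lobachevsky g + lobachevsky ((π + x - y - g) / 2) + lobachevsky ((π - x + y - g) / 2)
    + lobachevsky ((π + x + y - g) / 2) + lobachevsky ((π - x - y - g) / 2)

/-- The Schläfli-type formula for one corner: the partial derivatives of `cornerW` with respect to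
the two sides are hyperbolic distances, the one with respect to the corner is the logarithm of a
radius. -/
lemma hasDerivAt_cornerW {x y g : ℝ → ℝ} {x' y' g' s : ℝ} (dx : HasDerivAt x x' s)
    (dy : HasDerivAt y y' s) (dg : HasDerivAt g g' s) (hx : 0 < x s) (hy : 0 < y s)
    (hg : 0 < g s) (h : g s + x s + y s < π) :
    HasDerivAt (fun t => cornerW (x t) (y t) (g t))
      (-cornerTau (x s) (y s) (g s) * x' - cornerTau (y s) (x s) (g s) * y'
        + log (cornerRad (x s) (y s) (g s)) * g') s := by
  have d0 := (hasDerivAt_lobachevsky hg (by linarith)).comp s dg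
  have d1 := HasDerivAt.comp (h := fun t => (π + x t - y t - g t) / 2) s
    (hasDerivAt_lobachevsky (x := (π + x s - y s - g s) / 2) (by linarith) (by linarith))
    ((((dx.const_add π).sub dy).sub dg).div_const 2)
  have d2 := HasDerivAt.comp (h := fun t => (π - x t + y t - g t) / 2) s
    (hasDerivAt_lobachevsky (x := (π - x s + y s - g s) / 2) (by linarith) (by linarith))
    ((((dx.const_sub π).add dy).sub dg).div_const 2)
  have d3 := HasDerivAt.comp (h := fun t => (π + x t + y t - g t) / 2) s
    (hasDerivAt_lobachevsky (x := (π + x s + y s - g s) / 2) (by linarith) (by linarith))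
    ((((dx.const_add π).add dy).sub dg).div_const 2)
  have d4 := HasDerivAt.comp (h := fun t => (π - x t - y t - g t) / 2) s
    (hasDerivAt_lobachevsky (x := (π - x s - y s - g s) / 2) (by linarith) (by linarith))
    ((((dx.const_sub π).sub dy).sub dg).div_const 2)
  refine ((((d0.add d1).add d2).add d3).add d4).congr_deriv ?_
  have s0 : 0 < sin (g s) := sin_pos_of_pos_of_lt_pi hg (by linarith)
  have s1 : 0 < sin ((π + x s - y s - g s) / 2) :=
    sin_pos_of_pos_of_lt_pi (by linarith) (by linarith)
  have s2 : 0 < sin ((π - x s + y s - g s) / 2) :=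
    sin_pos_of_pos_of_lt_pi (by linarith) (by linarith)
  have s3 : 0 < sin ((π + x s + y s - g s) / 2) :=
    sin_pos_of_pos_of_lt_pi (by linarith) (by linarith)
  have s4 : 0 < sin ((π - x s - y s - g s) / 2) :=
    sin_pos_of_pos_of_lt_pi (by linarith) (by linarith)
  have c1 : π + y s - x s - g s = π - x s + y s - g s := by ring
  have c2 : π + y s + x s - g s = π + x s + y s - g s := by ring
  have c3 : π - y s + x s - g s = π + x s - y s - g s := by ring
  have c4 : π - y s - x s - g s = π - x s - y s - g s := by ring
  rw [cornerTau_eq hx hy hg h, cornerTau_eq hy hx hg (by linarith), log_cornerRad hx hy hg h,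
    footDist_add_sin s0.ne', footDist_sub_sin s0.ne', footDist_add_sin s0.ne',
    footDist_sub_sin s0.ne', c1, c2, c3, c4]
  rw [log_div (by positivity) s0.ne', log_div (by positivity) s0.ne',
    log_div (by positivity) s0.ne', log_div (by positivity) s0.ne',
    log_mul (by positivity) (by positivity), log_mul (by positivity) (by positivity),
    log_mul (by positivity) (by positivity), log_mul (by positivity) (by positivity),
    log_mul (by positivity) (by positivity), log_mul (by positivity) (by positivity),
    log_mul (by positivity) (by positivity), log_mul (by positivity) (by positivity)]
  ring

/-! ### The derivative of the volume -/

/-- Twice the partial derivative of `triangleV` with respect to the angle at corner `k`. -/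
noncomputable def cornerGrad (a g : Fin 3 → ℝ) (k : Fin 3) : ℝ :=
  log (cornerRad (a (k + 1)) (a (k + 2)) (g k))

/-- Twice the partial derivative, up to sign, of `triangleV` with respect to the angle at the side
`k`: the length of the corresponding truncated edge of the hyperideal tetrahedron. -/
noncomputable def sideGrad (a g : Fin 3 → ℝ) (k : Fin 3) : ℝ :=
  cornerTau (a k) (a (k + 2)) (g (k + 1)) + cornerTau (a k) (a (k + 1)) (g (k + 2))

lemma hasDerivAt_triangleV {a g : ℝ → Fin 3 → ℝ} {a' g' : Fin 3 → ℝ} {s : ℝ}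
    (da : ∀ k, HasDerivAt (fun t => a t k) (a' k) s) (dg : ∀ k, HasDerivAt (fun t => g t k) (g' k) s)
    (h : IsTriangleAngles (a s) (g s)) :
    HasDerivAt (fun t => triangleV (a t) (g t))
      ((1 / 2) * ∑ k, (cornerGrad (a s) (g s) k * g' k - sideGrad (a s) (g s) k * a' k)) s := by
  have hW := fun k : Fin 3 => hasDerivAt_cornerW (da (k + 1)) (da (k + 2)) (dg k) (h.side_pos _)
    (h.side_pos _) (h.corner_pos _) (h.lt_pi k)
  have := (HasDerivAt.fun_sum (u := Finset.univ) fun k _ => hW k).const_mul (1 / 2)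
  refine this.congr_deriv ?_
  simp only [Fin.sum_univ_three, cornerGrad, sideGrad]
  simp only [Fin.isValue, show (0 : Fin 3) + 1 = 1 from rfl, show (0 : Fin 3) + 2 = 2 from rfl,
    show (1 : Fin 3) + 1 = 2 from rfl, show (1 : Fin 3) + 2 = 0 from rfl,
    show (2 : Fin 3) + 1 = 0 from rfl, show (2 : Fin 3) + 2 = 1 from rfl]
  ring

lemma sideGrad_pos {a g : Fin 3 → ℝ} (h : IsTriangleAngles a g) (k : Fin 3) :
    0 < sideGrad a g k := by
  have h1 := h.lt_pi (k + 1)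
  have h2 := h.lt_pi (k + 2)
  rw [fin3_add_one_add_one, fin3_add_one_add_two] at h1
  rw [fin3_add_two_add_one, fin3_add_two_add_two] at h2
  exact add_pos
    (cornerTau_pos (h.side_pos _) (h.side_pos _) (h.corner_pos _) (by linarith))
    (cornerTau_pos (h.side_pos _) (h.side_pos _) (h.corner_pos _) (by linarith))

/-! ### Orthonormal frames in the plane -/

/-- `u` is the unit vector from `A` to `B`, and `N` the unit normal to the line `AB` pointing to the
side of `K`. -/
structure IsSideFrame (A B K u N : Plane) : Prop where
  uu : ⟪u, u⟫ = 1
  NN : ⟪N, N⟫ = 1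
  uN : ⟪u, N⟫ = 0
  sub : B - A = dist A B • u
  pos : 0 < ⟪N, K - A⟫

lemma plane_inner (v w : Plane) : ⟪v, w⟫ = v 0 * w 0 + v 1 * w 1 := by
  simp [PiLp.inner_apply, Fin.sum_univ_two, mul_comm]

lemma plane_inner_eq {u N : Plane} (uu : ⟪u, u⟫ = 1) (NN : ⟪N, N⟫ = 1) (uN : ⟪u, N⟫ = 0)
    (v w : Plane) : ⟪v, w⟫ = ⟪u, v⟫ * ⟪u, w⟫ + ⟪N, v⟫ * ⟪N, w⟫ := by
  simp only [plane_inner] at *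
  have hM : !![u 0, u 1; N 0, N 1] * !![u 0, N 0; u 1, N 1] = 1 := by
    rw [Matrix.mul_fin_two, uu, uN, NN, mul_comm (N 0), mul_comm (N 1), uN, Matrix.one_fin_two]
  rw [mul_eq_one_comm, Matrix.mul_fin_two, Matrix.one_fin_two] at hM
  have h00 := congrFun (congrFun hM 0) 0
  have h01 := congrFun (congrFun hM 0) 1
  have h11 := congrFun (congrFun hM 1) 1
  simp at h00 h01 h11
  linear_combination (-v 0 * w 0) * h00 - (v 0 * w 1 + v 1 * w 0) * h01 - v 1 * w 1 * h11

lemma plane_decomp {u N : Plane} (uu : ⟪u, u⟫ = 1) (NN : ⟪N, N⟫ = 1) (uN : ⟪u, N⟫ = 0)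
    (w : Plane) : w = ⟪u, w⟫ • u + ⟪N, w⟫ • N := by
  refine ext_inner_left ℝ fun v => ?_
  rw [plane_inner_eq uu NN uN v w, inner_add_right, inner_smul_right, inner_smul_right,
    real_inner_comm u v, real_inner_comm N v]
  ring

lemma exists_sideFrame {A B K : Plane} (h : ¬ Collinear ℝ {A, B, K}) :
    ∃ u N, IsSideFrame A B K u N := by
  have hAB : A ≠ B := fun e => h (by rw [e]; simpa using collinear_pair ℝ B K)
  have hd : 0 < dist A B := dist_pos.2 hAB
  set u : Plane := (dist A B)⁻¹ • (B - A) with hu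
  have hsub : B - A = dist A B • u := by rw [hu, smul_inv_smul₀ hd.ne']
  have huu : ⟪u, u⟫ = 1 := by
    rw [real_inner_self_eq_norm_sq, hu, norm_smul, norm_inv, norm_of_nonneg hd.le,
      ← dist_eq_norm, dist_comm B A, inv_mul_cancel₀ hd.ne', one_pow]
  set J : Plane := !₂[-u 1, u 0] with hJ
  have hJJ : ⟪J, J⟫ = 1 := by
    rw [plane_inner] at huu ⊢
    simp only [hJ, PiLp.toLp_apply, Matrix.cons_val_zero, Matrix.cons_val_one]
    linarith
  have huJ : ⟪u, J⟫ = 0 := by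
    rw [plane_inner]
    simp only [hJ, PiLp.toLp_apply, Matrix.cons_val_zero, Matrix.cons_val_one]
    ring
  have hne : ⟪J, K - A⟫ ≠ 0 := by
    intro h0
    apply h
    have hK := plane_decomp huu hJJ huJ (K - A)
    rw [h0, zero_smul, add_zero] at hK
    refine (collinear_iff_of_mem (p₀ := A) (by simp)).2 ⟨u, ?_⟩
    rintro p (rfl | rfl | rfl)
    · exact ⟨0, by simp⟩
    · exact ⟨_, by rw [vadd_eq_add, ← hsub, sub_add_cancel]⟩
    · exact ⟨_, by rw [vadd_eq_add, ← hK, sub_add_cancel]⟩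
  rcases hne.lt_or_gt with hn | hn
  · refine ⟨u, -J, huu, by simpa using hJJ, by simpa using huJ, hsub, ?_⟩
    rw [inner_neg_left]; linarith
  · exact ⟨u, J, huu, hJJ, huJ, hsub, hn⟩

namespace IsSideFrame

variable {A B K u N : Plane}

lemma inner_eq (f : IsSideFrame A B K u N) (v w : Plane) :
    ⟪v, w⟫ = ⟪u, v⟫ * ⟪u, w⟫ + ⟪N, v⟫ * ⟪N, w⟫ := plane_inner_eq f.uu f.NN f.uN v w

lemma inner_sub_left (f : IsSideFrame A B K u N) : ⟪u, B - A⟫ = dist A B := by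
  rw [f.sub, inner_smul_right, f.uu, mul_one]

lemma inner_sub_right (f : IsSideFrame A B K u N) : ⟪N, B - A⟫ = 0 := by
  rw [f.sub, inner_smul_right, real_inner_comm, f.uN, mul_zero]

lemma inner_sub_eq (f : IsSideFrame A B K u N) (C : Plane) : ⟪N, C - B⟫ = ⟪N, C - A⟫ := by
  have := f.inner_sub_right
  rw [show C - A = (C - B) + (B - A) by abel, inner_add_right, this, add_zero]

lemma swap (f : IsSideFrame A B K u N) : IsSideFrame B A K (-u) N where
  uu := by simpa using f.uu
  NN := f.NN
  uN := by simpa using f.uN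
  sub := by rw [dist_comm, smul_neg, ← f.sub, neg_sub]
  pos := by rw [f.inner_sub_eq]; exact f.pos

/-- A normal vector pointing to the side of `K` is a positive multiple of `N`. -/
lemma normal_eq (f : IsSideFrame A B K u N) (hAB : A ≠ B) {n : Plane} (h0 : ⟪n, B - A⟫ = 0)
    (h1 : 0 < ⟪n, K - A⟫) : 0 < ⟪N, n⟫ ∧ n = ⟪N, n⟫ • N := by
  have hun : ⟪u, n⟫ = 0 := by
    rw [f.sub, inner_smul_right] at h0
    rw [real_inner_comm]
    exact (mul_eq_zero.1 h0).resolve_left (dist_ne_zero.2 hAB)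
  have hn := plane_decomp f.uu f.NN f.uN n
  rw [hun, zero_smul, zero_add] at hn
  refine ⟨?_, hn⟩
  rw [hn, inner_smul_left] at h1
  exact pos_of_mul_pos_left h1 f.pos.le

lemma unique (f : IsSideFrame A B K u N) (hAB : A ≠ B) {v M : Plane} (f' : IsSideFrame A B K v M) :
    v = u ∧ M = N := by
  constructor
  · exact smul_right_injective _ (dist_ne_zero.2 hAB) (f'.sub.symm.trans f.sub)
  · obtain ⟨hp, he⟩ := f.normal_eq hAB f'.inner_sub_right f'.pos
    have h1 : ⟪N, M⟫ ^ 2 = 1 := by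
      have := f'.NN
      rw [he, inner_smul_left, inner_smul_right, f.NN] at this
      simpa [sq] using this
    rw [(pow_eq_one_iff_of_nonneg hp.le two_ne_zero).1 h1, one_smul] at he
    exact he

/-- Distances in the coordinates of a frame. -/
lemma dist_sq (f : IsSideFrame A B K u N) (P Q : Plane) :
    dist P Q ^ 2 = (⟪u, P - A⟫ - ⟪u, Q - A⟫) ^ 2 + (⟪N, P - A⟫ - ⟪N, Q - A⟫) ^ 2 := by
  rw [dist_eq_norm, ← real_inner_self_eq_norm_sq, f.inner_eq, ← _root_.inner_sub_right,
    ← _root_.inner_sub_right, sub_sub_sub_cancel_right]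
  ring

lemma dist_left_sq (f : IsSideFrame A B K u N) (P : Plane) :
    dist P A ^ 2 = ⟪u, P - A⟫ ^ 2 + ⟪N, P - A⟫ ^ 2 := by
  simp [f.dist_sq]

lemma dist_right_sq (f : IsSideFrame A B K u N) (P : Plane) :
    dist P B ^ 2 = (⟪u, P - A⟫ - dist A B) ^ 2 + ⟪N, P - A⟫ ^ 2 := by
  rw [f.dist_sq, f.inner_sub_left, f.inner_sub_right, sub_zero]

end IsSideFrame

/-- `C` has signed distance `h` from the line `AB`, counted positive on the side of `K`. -/
def HasSignedDist (A B K C : Plane) (h : ℝ) : Prop :=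
  ∀ u N, IsSideFrame A B K u N → ⟪N, C - A⟫ = h

lemma HasSignedDist.swap {A B K C : Plane} {h : ℝ} (H : HasSignedDist A B K C h) :
    HasSignedDist B A K C h := fun _ _ f => by
  rw [← H _ _ f.swap, f.inner_sub_eq]

lemma HasSignedDist.of_frame {A B K C u N : Plane} {h : ℝ} (hAB : A ≠ B)
    (f : IsSideFrame A B K u N) (H : ⟪N, C - A⟫ = h) : HasSignedDist A B K C h := fun _ _ f' => by
  rw [(f.unique hAB f').2, H]

/-- The distance along a side from the corner `A` to the foot of the perpendicular from a point `C`
is determined by the angle at `A` and the signed distances of `C` from the adjacent sides. -/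
lemma inner_eq_footDist {A B K C u N : Plane} {R x y g : ℝ} (nc : ¬ Collinear ℝ {A, B, K})
    (hg : EuclideanGeometry.angle B A K = g) (hx : HasSignedDist A B K C (R * cos x))
    (hy : HasSignedDist A K B C (R * cos y)) (f : IsSideFrame A B K u N) :
    ⟪u, C - A⟫ = R * footDist x y g := by
  have nc' : ¬ Collinear ℝ {A, K, B} := by rwa [Set.pair_comm]
  obtain ⟨v, M, f'⟩ := exists_sideFrame nc'
  have hAB : A ≠ B := fun e => nc (by rw [e]; simpa using collinear_pair ℝ B K)
  have hAK : A ≠ K := fun e => nc' (by rw [e]; simpa using collinear_pair ℝ K B)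
  have hlB : 0 < dist A B := dist_pos.2 hAB
  have hlK : 0 < dist A K := dist_pos.2 hAK
  have hcos : ⟪u, v⟫ = cos g := by
    rw [← hg, EuclideanGeometry.angle, vsub_eq_sub, vsub_eq_sub, f.sub, f'.sub,
      InnerProductGeometry.angle_smul_left_of_pos _ _ hlB,
      InnerProductGeometry.angle_smul_right_of_pos _ _ hlK, InnerProductGeometry.cos_angle]
    have h1 := f.uu
    have h2 := f'.uu
    rw [real_inner_self_eq_norm_sq, pow_eq_one_iff_of_nonneg (norm_nonneg _) two_ne_zero] at h1 h2
    rw [h1, h2]; simp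
  have hsg : 0 ≤ sin g := by
    rw [← hg]
    exact sin_nonneg_of_nonneg_of_le_pi (EuclideanGeometry.angle_nonneg _ _ _)
      (EuclideanGeometry.angle_le_pi _ _ _)
  have hvpos : 0 < ⟪N, v⟫ := by
    have := f.pos
    rw [f'.sub, inner_smul_right] at this
    exact pos_of_mul_pos_right this hlK.le
  have hMpos : 0 < ⟪u, M⟫ := by
    have := f'.pos
    rw [f.sub, inner_smul_right, real_inner_comm] at this
    exact pos_of_mul_pos_right this hlB.le
  have htrig := sin_sq_add_cos_sq g
  have hvN : ⟪N, v⟫ = sin g := by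
    have := f.inner_eq v v
    rw [f'.uu, hcos] at this
    exact (pow_left_inj₀ hvpos.le hsg two_ne_zero).1 (by linarith)
  rw [hvN] at hvpos
  have hMM := f.inner_eq M M
  have hvM := f.inner_eq v M
  rw [f'.NN] at hMM
  rw [f'.uN, hcos, hvN] at hvM
  have hMu : ⟪u, M⟫ = sin g := by
    refine (pow_left_inj₀ hMpos.le hsg two_ne_zero).1 ?_
    linear_combination (sin g * ⟪N, M⟫ - cos g * ⟪u, M⟫) * hvM - sin g ^ 2 * hMM
      - ⟪u, M⟫ ^ 2 * htrig
  have hMN : ⟪N, M⟫ = - cos g := by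
    rw [hMu] at hvM
    exact mul_left_cancel₀ hvpos.ne' (by linarith)
  have e1 := f.inner_eq M (C - A)
  rw [hy _ _ f', hx _ _ f, hMu, hMN] at e1
  rw [footDist, ← mul_div_assoc, eq_div_iff hvpos.ne']
  linarith

/-! ### Triangles with a face-circle -/

/-- A triangle with vertices `pt` and corner angles `g` such that, for each side `k`, the center `C`
has signed distance `R cos (a k)` from this side. -/
structure HasAngleData (pt : Fin 3 → Plane) (C : Plane) (R : ℝ) (a g : Fin 3 → ℝ) : Prop where
  noncollinear : ∀ k, ¬ Collinear ℝ {pt k, pt (k + 1), pt (k + 2)}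
  corner : ∀ k, EuclideanGeometry.angle (pt (k + 1)) (pt k) (pt (k + 2)) = g k
  side : ∀ k, HasSignedDist (pt (k + 1)) (pt (k + 2)) (pt k) C (R * cos (a k))

namespace HasAngleData

variable {pt : Fin 3 → Plane} {C : Plane} {R : ℝ} {a g : Fin 3 → ℝ}

lemma noncollinear_rotate (H : HasAngleData pt C R a g) (k : Fin 3) :
    ¬ Collinear ℝ {pt (k + 1), pt (k + 2), pt k} := by
  have := H.noncollinear (k + 1)
  rwa [fin3_add_one_add_one, fin3_add_one_add_two] at this

lemma side_left (H : HasAngleData pt C R a g) (k : Fin 3) :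
    HasSignedDist (pt k) (pt (k + 1)) (pt (k + 2)) C (R * cos (a (k + 2))) := by
  have := H.side (k + 2)
  rwa [fin3_add_two_add_one, fin3_add_two_add_two] at this

lemma side_right (H : HasAngleData pt C R a g) (k : Fin 3) :
    HasSignedDist (pt k) (pt (k + 2)) (pt (k + 1)) C (R * cos (a (k + 1))) := by
  have := (H.side (k + 1)).swap
  rwa [fin3_add_one_add_one, fin3_add_one_add_two] at this

lemma dist_center_sq (H : HasAngleData pt C R a g) (h : IsTriangleAngles a g) (k : Fin 3) :
    dist C (pt k) ^ 2 = R ^ 2 + (R * cornerRad (a (k + 1)) (a (k + 2)) (g k)) ^ 2 := by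
  obtain ⟨u, N, f⟩ := exists_sideFrame (H.noncollinear k)
  have hf := inner_eq_footDist (H.noncollinear k) (H.corner k) (H.side_left k) (H.side_right k) f
  have hs : sin (g k) ≠ 0 := (sin_pos_of_pos_of_lt_pi (h.corner_pos k)
    (by linarith [h.lt_pi k, h.side_pos (k + 1), h.side_pos (k + 2)])).ne'
  rw [f.dist_left_sq, hf, H.side_left k _ _ f, mul_pow, mul_pow R (cornerRad _ _ _),
    cornerRad_comm hs, cornerRad_sq (h.side_pos _) (h.side_pos _) (h.corner_pos _)
    (by linarith [h.lt_pi k])]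
  linear_combination R ^ 2 * sin_sq_add_cos_sq (a (k + 2))

lemma dist_eq (H : HasAngleData pt C R a g) (k : Fin 3) :
    dist (pt (k + 1)) (pt (k + 2))
      = R * footDist (a k) (a (k + 2)) (g (k + 1)) + R * footDist (a k) (a (k + 1)) (g (k + 2)) := by
  obtain ⟨u, N, f⟩ := exists_sideFrame (H.noncollinear_rotate k)
  have n1 := H.noncollinear (k + 1)
  have n2 := H.noncollinear (k + 2)
  have c1 := H.corner (k + 1)
  have c2 := H.corner (k + 2)
  rw [EuclideanGeometry.angle_comm] at c2
  have l1 := H.side_left (k + 1)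
  have l2 := H.side_left (k + 2)
  have r1 := H.side_right (k + 1)
  have r2 := H.side_right (k + 2)
  simp only [fin3_add_one_add_one, fin3_add_one_add_two, fin3_add_two_add_one, fin3_add_two_add_two]
    at n1 n2 c1 c2 l1 l2 r1 r2
  rw [← inner_eq_footDist n1 c1 l1 r1 f,
    ← inner_eq_footDist (by rwa [Set.pair_comm]) c2 r2 l2
      f.swap, inner_neg_left, ← sub_eq_add_neg, ← inner_sub_right, sub_sub_sub_cancel_left,
    f.inner_sub_left]

end HasAngleData

namespace IsTriangleAngles

variable {a g : Fin 3 → ℝ}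

lemma sin_corner_pos (h : IsTriangleAngles a g) (k : Fin 3) : 0 < sin (g k) :=
  sin_pos_of_pos_of_lt_pi (h.corner_pos k)
    (by linarith [h.lt_pi k, h.side_pos (k + 1), h.side_pos (k + 2)])

lemma sin_side_pos (h : IsTriangleAngles a g) (k : Fin 3) : 0 < sin (a k) := by
  refine sin_pos_of_pos_of_lt_pi (h.side_pos k) ?_
  have := h.lt_pi (k + 1)
  rw [fin3_add_one_add_one, fin3_add_one_add_two] at this
  linarith [h.corner_pos (k + 1), h.side_pos (k + 2)]

lemma lt_pi_left (h : IsTriangleAngles a g) (k : Fin 3) : g (k + 1) + a k + a (k + 2) < π := by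
  have := h.lt_pi (k + 1)
  rw [fin3_add_one_add_one, fin3_add_one_add_two] at this
  linarith

lemma lt_pi_right (h : IsTriangleAngles a g) (k : Fin 3) : g (k + 2) + a k + a (k + 1) < π := by
  have := h.lt_pi (k + 2)
  rwa [fin3_add_two_add_one, fin3_add_two_add_two] at this

lemma cornerRad_pos (h : IsTriangleAngles a g) (k : Fin 3) :
    0 < cornerRad (a (k + 1)) (a (k + 2)) (g k) :=
  _root_.cornerRad_pos (h.side_pos _) (h.side_pos _) (h.corner_pos _) (h.lt_pi k)

lemma exp_cornerGrad (h : IsTriangleAngles a g) (k : Fin 3) :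
    exp (cornerGrad a g k) = cornerRad (a (k + 1)) (a (k + 2)) (g k) :=
  exp_log (h.cornerRad_pos k)

lemma exp_cornerGrad_left (h : IsTriangleAngles a g) (k : Fin 3) :
    exp (cornerGrad a g (k + 1)) = cornerRad (a k) (a (k + 2)) (g (k + 1)) := by
  rw [h.exp_cornerGrad, fin3_add_one_add_one, fin3_add_one_add_two,
    cornerRad_comm (h.sin_corner_pos _).ne']

lemma exp_cornerGrad_right (h : IsTriangleAngles a g) (k : Fin 3) :
    exp (cornerGrad a g (k + 2)) = cornerRad (a k) (a (k + 1)) (g (k + 2)) := by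
  rw [h.exp_cornerGrad, fin3_add_two_add_one, fin3_add_two_add_two]

end IsTriangleAngles

namespace HasAngleData

variable {pt : Fin 3 → Plane} {C : Plane} {R : ℝ} {a g : Fin 3 → ℝ}

lemma exp_add_exp_lt_dist (H : HasAngleData pt C R a g) (hR : 0 < R) (h : IsTriangleAngles a g)
    (k : Fin 3) : R * exp (cornerGrad a g (k + 1)) + R * exp (cornerGrad a g (k + 2))
      < dist (pt (k + 1)) (pt (k + 2)) := by
  rw [H.dist_eq, h.exp_cornerGrad_left, h.exp_cornerGrad_right,
    ← cornerRad_mul_cosh (h.side_pos _) (h.side_pos _) (h.corner_pos _) (h.lt_pi_left k),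
    ← cornerRad_mul_cosh (h.side_pos _) (h.side_pos _) (h.corner_pos _) (h.lt_pi_right k)]
  have r1 := cornerRad_pos (h.side_pos _) (h.side_pos _) (h.corner_pos _) (h.lt_pi_left k)
  have r2 := cornerRad_pos (h.side_pos _) (h.side_pos _) (h.corner_pos _) (h.lt_pi_right k)
  have c1 := one_lt_cosh.2
    (cornerTau_pos (h.side_pos _) (h.side_pos _) (h.corner_pos _) (h.lt_pi_left k)).ne'
  have c2 := one_lt_cosh.2
    (cornerTau_pos (h.side_pos _) (h.side_pos _) (h.corner_pos _) (h.lt_pi_right k)).ne'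
  gcongr <;> nlinarith

/-- The length of a side in terms of the adjacent radii and of the length of the truncated edge of
the hyperideal tetrahedron. -/
lemma dist_sq_eq (H : HasAngleData pt C R a g) (h : IsTriangleAngles a g) (k : Fin 3) :
    dist (pt (k + 1)) (pt (k + 2)) ^ 2
      = (R * exp (cornerGrad a g (k + 1))) ^ 2 + (R * exp (cornerGrad a g (k + 2))) ^ 2
        + 2 * (R * exp (cornerGrad a g (k + 1))) * (R * exp (cornerGrad a g (k + 2)))
          * cosh (sideGrad a g k) := by
  have c1 := cornerRad_mul_cosh (h.side_pos _) (h.side_pos _) (h.corner_pos _) (h.lt_pi_left k)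
  have c2 := cornerRad_mul_cosh (h.side_pos _) (h.side_pos _) (h.corner_pos _) (h.lt_pi_right k)
  have s1 := cornerRad_mul_sinh (h.side_pos _) (h.side_pos _) (h.corner_pos _) (h.lt_pi_left k)
  have s2 := cornerRad_mul_sinh (h.side_pos _) (h.side_pos _) (h.corner_pos _) (h.lt_pi_right k)
  have q1 := cosh_sq (cornerTau (a k) (a (k + 2)) (g (k + 1)))
  have q2 := cosh_sq (cornerTau (a k) (a (k + 1)) (g (k + 2)))
  rw [H.dist_eq, h.exp_cornerGrad_left, h.exp_cornerGrad_right, sideGrad, cosh_add, ← c1, ← c2]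
  set ρ := cornerRad (a k) (a (k + 2)) (g (k + 1))
  set ρ' := cornerRad (a k) (a (k + 1)) (g (k + 2))
  set t := cornerTau (a k) (a (k + 2)) (g (k + 1))
  set t' := cornerTau (a k) (a (k + 1)) (g (k + 2))
  have e : ρ * sinh t = ρ' * sinh t' := s1.trans s2.symm
  linear_combination (R * ρ) ^ 2 * q1 + (R * ρ') ^ 2 * q2 + R ^ 2 * (ρ * sinh t - ρ' * sinh t') * e

end HasAngleData

/-! ### Decorated triangles and their angles -/

namespace DecoratedTriangle

variable (D : DecoratedTriangle) {a g : Fin 3 → ℝ}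

lemma not_collinear (k : Fin 3) : ¬ Collinear ℝ {D.pt k, D.pt (k + 1), D.pt (k + 2)} := by
  rw [← affineIndependent_iff_not_collinear_of_ne (p := D.pt) (by revert k; decide)
    (by revert k; decide) (by revert k; decide)]
  exact D.affineIndependent

lemma pt_ne (k : Fin 3) : D.pt (k + 1) ≠ D.pt (k + 2) :=
  D.affineIndependent.injective.ne (by revert k; decide)

variable {D}

lemma IsSideAngle.hasSignedDist {k : Fin 3} {x : ℝ} (h : D.IsSideAngle k x) :
    HasSignedDist (D.pt (k + 1)) (D.pt (k + 2)) (D.pt k) D.faceCenter (D.faceRad * cos x) := by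
  obtain ⟨P, n, hP, hPC, hn0, hn1, rfl⟩ := h
  intro u N f
  obtain ⟨hpos, he⟩ := f.normal_eq (D.pt_ne k) hn0 hn1
  have hNP : ⟪N, P - D.pt (k + 1)⟫ = 0 := by
    obtain ⟨c, rfl⟩ := mem_affineSpan_pair_iff_exists_lineMap_eq.1 hP
    rw [AffineMap.lineMap_apply, vsub_eq_sub, vadd_eq_add, add_sub_cancel_right, inner_smul_right,
      f.inner_sub_right, mul_zero]
  have hN : ‖N‖ = 1 := by
    have := f.NN
    rwa [real_inner_self_eq_norm_sq, pow_eq_one_iff_of_nonneg (norm_nonneg _) two_ne_zero] at this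
  rw [he, InnerProductGeometry.angle_smul_left_of_pos _ _ hpos, InnerProductGeometry.cos_angle,
    hN, one_mul, ← dist_eq_norm, dist_comm, hPC, mul_div_cancel₀ _ D.faceRad_pos.ne',
    ← sub_sub_sub_cancel_right D.faceCenter P (D.pt (k + 1)),
    inner_sub_right _ (_ - _), hNP, sub_zero]

lemma isSideAngle_of_hasSignedDist {k : Fin 3} {x : ℝ} (h0 : 0 ≤ x) (h1 : x ≤ π)
    (h : HasSignedDist (D.pt (k + 1)) (D.pt (k + 2)) (D.pt k) D.faceCenter (D.faceRad * cos x)) :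
    D.IsSideAngle k x := by
  have nc := D.not_collinear (k + 1)
  rw [fin3_add_one_add_one, fin3_add_one_add_two] at nc
  obtain ⟨u, N, f⟩ := exists_sideFrame nc
  have hC := plane_decomp f.uu f.NN f.uN (D.faceCenter - D.pt (k + 1))
  rw [h u N f] at hC
  set σ := ⟪u, D.faceCenter - D.pt (k + 1)⟫
  have hl := dist_ne_zero.2 (D.pt_ne k)
  have hN : ‖N‖ = 1 := by
    have := f.NN
    rwa [real_inner_self_eq_norm_sq, pow_eq_one_iff_of_nonneg (norm_nonneg _) two_ne_zero] at this
  -- one of the two intersection points of the side with the face-circle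
  set P : Plane := D.pt (k + 1) + (σ + D.faceRad * sin x) • u with hP
  have hCP : D.faceCenter - P = D.faceRad • (cos x • N - sin x • u) := by
    rw [hP, ← sub_sub, hC]
    module
  have hnorm : ‖cos x • N - sin x • u‖ = 1 := by
    rw [← pow_eq_one_iff_of_nonneg (norm_nonneg _) two_ne_zero, ← real_inner_self_eq_norm_sq,
      f.inner_eq]
    simp only [inner_sub_right, inner_smul_right, f.uu, f.NN, f.uN, real_inner_comm u N]
    linarith [sin_sq_add_cos_sq x]
  refine ⟨P, N, ?_, ?_, f.inner_sub_right, f.pos, ?_⟩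
  · refine mem_affineSpan_pair_iff_exists_lineMap_eq.2
      ⟨(σ + D.faceRad * sin x) / dist (D.pt (k + 1)) (D.pt (k + 2)), ?_⟩
    rw [AffineMap.lineMap_apply, vsub_eq_sub, vadd_eq_add, f.sub, smul_smul,
      div_mul_cancel₀ _ hl, hP, add_comm]
  · rw [dist_comm, dist_eq_norm, hCP, norm_smul, hnorm, mul_one, norm_of_nonneg D.faceRad_pos.le]
  · rw [hCP, InnerProductGeometry.angle_smul_right_of_pos _ _ D.faceRad_pos,
      InnerProductGeometry.angle, hN, hnorm, inner_sub_right, inner_smul_right, inner_smul_right,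
      f.NN, real_inner_comm, f.uN]
    simpa using arccos_cos h0 h1

lemma HasAngles.hasAngleData (h : D.HasAngles a g) :
    HasAngleData D.pt D.faceCenter D.faceRad a g where
  noncollinear := D.not_collinear
  corner k := (h k).2
  side k := (h k).1.hasSignedDist

lemma HasAngles.rad_eq (h : D.HasAngles a g) (hag : IsTriangleAngles a g) (k : Fin 3) :
    D.rad k = D.faceRad * exp (cornerGrad a g k) := by
  have h1 := D.orthogonal k
  rw [h.hasAngleData.dist_center_sq hag, ← hag.exp_cornerGrad] at h1
  exact (pow_left_inj₀ (D.rad_pos k).le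
    (mul_pos D.faceRad_pos (exp_pos _)).le two_ne_zero).1 (by linarith)

lemma HasAngles.dist_sq_eq (h : D.HasAngles a g) (hag : IsTriangleAngles a g) (k : Fin 3) :
    dist (D.pt (k + 1)) (D.pt (k + 2)) ^ 2
      = D.rad (k + 1) ^ 2 + D.rad (k + 2) ^ 2
        + 2 * D.rad (k + 1) * D.rad (k + 2) * cosh (sideGrad a g k) := by
  rw [h.hasAngleData.dist_sq_eq hag, h.rad_eq hag, h.rad_eq hag]

end DecoratedTriangle

/-! ### Construction of a decorated triangle from its angles -/

/-- A triangle with prescribed angles, drawn around the center of its face-circle. -/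
lemma exists_hasAngleData {a g : Fin 3 → ℝ} (h : IsTriangleAngles a g) {R : ℝ} (hR : 0 < R) :
    ∃ pt : Fin 3 → Plane, HasAngleData pt 0 R a g := by
  -- `e k` is the unit direction of the side `k`, and `n k` its inner unit normal
  set e : Fin 3 → Plane :=
    ![!₂[1, 0], !₂[-cos (g 2), sin (g 2)], !₂[-cos (g 1), -sin (g 1)]] with he
  set n : Fin 3 → Plane :=
    ![!₂[0, 1], !₂[-sin (g 2), -cos (g 2)], !₂[sin (g 1), -cos (g 1)]] with hn
  have hg0 : g 0 = π - (g 1 + g 2) := by linarith [h.corner_sum]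
  have c0 : cos (g 0) = sin (g 1) * sin (g 2) - cos (g 1) * cos (g 2) := by
    rw [hg0, cos_pi_sub, cos_add]; ring
  have s0 : sin (g 0) = sin (g 1) * cos (g 2) + cos (g 1) * sin (g 2) := by
    rw [hg0, sin_pi_sub, sin_add]
  have p1 := sin_sq_add_cos_sq (g 1)
  have p2 := sin_sq_add_cos_sq (g 2)
  have ee : ∀ k, ⟪e k, e k⟫ = 1 := by
    intro k; rw [plane_inner]; fin_cases k <;> simp [he] <;> linarith
  have nn : ∀ k, ⟪n k, n k⟫ = 1 := by
    intro k; rw [plane_inner]; fin_cases k <;> simp [hn] <;> linarith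
  have en : ∀ k, ⟪e k, n k⟫ = 0 := by
    intro k; rw [plane_inner]; fin_cases k <;> simp [he, hn] <;> ring
  have rot : ∀ k, e (k + 2) = -cos (g k) • e (k + 1) + sin (g k) • n (k + 1)
      ∧ n (k + 2) = -cos (g k) • n (k + 1) - sin (g k) • e (k + 1) := by
    intro k
    constructor <;> ext i <;> fin_cases k <;> fin_cases i <;> simp [he, hn, c0, s0] <;> grind
  clear_value e n
  set σ : Fin 3 → ℝ := fun k => footDist (a (k + 1)) (a (k + 2)) (g k) with hσ
  set σ' : Fin 3 → ℝ := fun k => footDist (a (k + 2)) (a (k + 1)) (g k) with hσ'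
  set pt : Fin 3 → Plane := fun k => R • (σ k • e (k + 1) - cos (a (k + 1)) • n (k + 1)) with hpt
  -- the vertex `k` lies on the line of the side `k + 1` by definition, and here on that of `k + 2`
  have hpt' : ∀ k, pt k = R • (-σ' k • e (k + 2) - cos (a (k + 2)) • n (k + 2)) := by
    intro k
    have hs := h.sin_corner_pos k
    have htr := sin_sq_add_cos_sq (g k)
    have k1 : σ k = σ' k * cos (g k) + cos (a (k + 2)) * sin (g k) := by
      simp only [hσ, hσ', footDist]
      field_simp
      linear_combination (-cos (a (k + 2))) * htr
    have k2 : cos (a (k + 1)) = σ' k * sin (g k) - cos (a (k + 2)) * cos (g k) := by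
      simp only [hσ', footDist]
      field_simp
      ring
    simp only [hpt]
    rw [(rot k).1, (rot k).2, k1, k2]
    module
  have hσpos : ∀ k, 0 < σ k := fun k =>
    (h.sin_side_pos _).trans
      (sin_lt_footDist (h.side_pos _) (h.side_pos _) (h.corner_pos _) (h.lt_pi k))
  have hσ'pos : ∀ k, 0 < σ' k := fun k =>
    (h.sin_side_pos _).trans
      (sin_lt_footDist (h.side_pos _) (h.side_pos _) (h.corner_pos _) (by linarith [h.lt_pi k]))
  set l : Fin 3 → ℝ := fun k => R * (σ (k + 2) + σ' (k + 1)) with hl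
  have lpos : ∀ k, 0 < l k := fun k => mul_pos hR (add_pos (hσpos _) (hσ'pos _))
  have hsub : ∀ k, pt (k + 2) - pt (k + 1) = l k • e k := by
    intro k
    rw [hpt' (k + 1), fin3_add_one_add_two]
    simp only [hpt, hl]
    rw [fin3_add_two_add_one]
    module
  have hsub1 : ∀ k, pt (k + 1) - pt k = l (k + 2) • e (k + 2) := by
    intro k
    rw [← hsub, fin3_add_two_add_one, fin3_add_two_add_two]
  have hsub2 : ∀ k, pt (k + 2) - pt k = -(l (k + 1) • e (k + 1)) := by
    intro k
    rw [← hsub, fin3_add_one_add_one, fin3_add_one_add_two, neg_sub]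
  have norm_e : ∀ k, ‖e k‖ = 1 := fun k => by
    have := ee k
    rwa [real_inner_self_eq_norm_sq, pow_eq_one_iff_of_nonneg (norm_nonneg _) two_ne_zero] at this
  have ne : ∀ k, pt (k + 1) ≠ pt k := fun k hk => by
    have := hsub1 k
    rw [hk, sub_self] at this
    have h0 := congrArg norm this
    rw [norm_smul, norm_e, norm_zero, mul_one, norm_of_nonneg (lpos _).le] at h0
    exact (lpos _).ne h0
  have angle : ∀ k, EuclideanGeometry.angle (pt (k + 1)) (pt k) (pt (k + 2)) = g k := by
    intro k
    rw [EuclideanGeometry.angle, vsub_eq_sub, vsub_eq_sub, hsub1, hsub2, ← smul_neg,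
      InnerProductGeometry.angle_smul_left_of_pos _ _ (lpos _),
      InnerProductGeometry.angle_smul_right_of_pos _ _ (lpos _), InnerProductGeometry.angle,
      norm_neg, norm_e, norm_e, inner_neg_right, (rot k).1, inner_add_left, inner_smul_left,
      inner_smul_left, ee, real_inner_comm, en]
    simpa using arccos_cos (h.corner_pos k).le
      (by linarith [h.lt_pi k, h.side_pos (k + 1), h.side_pos (k + 2)])
  have nc : ∀ k, ¬ Collinear ℝ {pt k, pt (k + 1), pt (k + 2)} := by
    intro k hk
    rw [Set.insert_comm, EuclideanGeometry.collinear_iff_eq_or_eq_or_angle_eq_zero_or_angle_eq_pi]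
      at hk
    have := h.corner_pos k
    have := h.lt_pi k
    have := h.side_pos (k + 1)
    have := h.side_pos (k + 2)
    rw [angle] at hk
    rcases hk with hk | hk | hk | hk
    · exact ne k hk
    · have := ne (k + 2)
      rw [fin3_add_two_add_one] at this
      exact this hk.symm
    · linarith
    · linarith
  refine ⟨pt, nc, angle, fun k => ?_⟩
  have hne : pt (k + 1) ≠ pt (k + 2) := by
    have := ne (k + 1)
    rw [fin3_add_one_add_one] at this
    exact this.symm
  have hdist : dist (pt (k + 1)) (pt (k + 2)) = l k := by
    rw [dist_comm, dist_eq_norm, hsub, norm_smul, norm_e, mul_one, norm_of_nonneg (lpos _).le]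
  have hnk : ⟪n k, e (k + 2)⟫ = -sin (g (k + 1)) := by
    have h2 := (rot (k + 1)).2
    rw [fin3_add_one_add_one, fin3_add_one_add_two] at h2
    rw [h2, inner_sub_left, inner_smul_left, inner_smul_left, ee, real_inner_comm, en]
    simp
  refine HasSignedDist.of_frame (u := e k) (N := n k) hne
    ⟨ee k, nn k, en k, by rw [hdist, hsub], ?_⟩ ?_
  · have : pt k - pt (k + 1) = -(l (k + 2) • e (k + 2)) := by rw [← hsub1, neg_sub]
    rw [this, inner_neg_right, inner_smul_right, hnk]
    have := mul_pos (lpos (k + 2)) (h.sin_corner_pos (k + 1))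
    linarith
  · rw [hpt' (k + 1), fin3_add_one_add_two, zero_sub, inner_neg_right, inner_smul_right,
      inner_sub_right, inner_smul_right, inner_smul_right, nn, real_inner_comm, en]
    ring

lemma exists_decoratedTriangle {a g : Fin 3 → ℝ} (h : IsTriangleAngles a g) {R : ℝ} (hR : 0 < R) :
    ∃ D : DecoratedTriangle, D.faceRad = R ∧ D.HasAngles a g := by
  obtain ⟨pt, H⟩ := exists_hasAngleData h hR
  have hdisj := fun k => H.exp_add_exp_lt_dist hR h k
  refine ⟨⟨pt, fun k => R * exp (cornerGrad a g k), 0, R, ?_, fun k => by positivity, hR, ?_, ?_⟩,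
    rfl, fun k => ⟨?_, H.corner k⟩⟩
  · rw [affineIndependent_iff_not_collinear_of_ne (p := pt) (i₁ := 0) (i₂ := 1) (i₃ := 2)
      (by decide) (by decide) (by decide)]
    exact H.noncollinear 0
  · intro i j hij
    have h0 := hdisj 0
    have h1 := hdisj 1
    have h2 := hdisj 2
    have d0 := dist_comm (pt 0) (pt 1)
    have d1 := dist_comm (pt 1) (pt 2)
    have d2 := dist_comm (pt 2) (pt 0)
    fin_cases i <;> fin_cases j <;> simp at hij h0 h1 h2 ⊢ <;> linarith
  · intro k
    rw [H.dist_center_sq h, h.exp_cornerGrad]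
  · refine DecoratedTriangle.isSideAngle_of_hasSignedDist (h.side_pos k).le ?_ (H.side k)
    linarith [h.lt_pi_left k, h.corner_pos (k + 1), h.side_pos (k + 2)]

/-! ### Congruence and the local Delaunay condition -/

lemma coord_eq_of_dist_eq {L S Q S' Q' : ℝ} (hL : 0 < L) (hQ : 0 < Q) (hQ' : 0 < Q')
    (h1 : S ^ 2 + Q ^ 2 = S' ^ 2 + Q' ^ 2) (h2 : (S - L) ^ 2 + Q ^ 2 = (S' - L) ^ 2 + Q' ^ 2) :
    S = S' ∧ Q = Q' := by
  have hS : S = S' := mul_left_cancel₀ hL.ne' (by linarith)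
  subst hS
  exact ⟨rfl, (pow_left_inj₀ hQ.le hQ'.le two_ne_zero).1 (by linarith)⟩

/-- The face-circle is determined, up to congruence, by the side lengths and the radii. -/
lemma faceCircle_congr {A B K C u N A' B' K' C' u' N' : Plane} {R R' a b c : ℝ}
    (f : IsSideFrame A B K u N) (f' : IsSideFrame A' B' K' u' N') (hAB : A ≠ B)
    (d1 : dist A' B' = dist A B) (d2 : dist K' A' = dist K A) (d3 : dist K' B' = dist K B)
    (oA : dist C A ^ 2 = R ^ 2 + a ^ 2) (oB : dist C B ^ 2 = R ^ 2 + b ^ 2)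
    (oK : dist C K ^ 2 = R ^ 2 + c ^ 2) (oA' : dist C' A' ^ 2 = R' ^ 2 + a ^ 2)
    (oB' : dist C' B' ^ 2 = R' ^ 2 + b ^ 2) (oK' : dist C' K' ^ 2 = R' ^ 2 + c ^ 2) :
    ⟪N', C' - A'⟫ = ⟪N, C - A⟫ ∧ R' ^ 2 = R ^ 2 := by
  have hL : 0 < dist A B := dist_pos.2 hAB
  have k1 := f.dist_left_sq K
  have k2 := f.dist_right_sq K
  have k1' := f'.dist_left_sq K'
  have k2' := f'.dist_right_sq K'
  rw [d1] at k2'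
  rw [d2, k1] at k1'
  rw [d3, k2] at k2'
  obtain ⟨hS, hQ⟩ := coord_eq_of_dist_eq hL f.pos f'.pos k1' k2'
  rw [f.dist_left_sq] at oA
  rw [f.dist_right_sq] at oB
  rw [f.dist_sq] at oK
  rw [f'.dist_left_sq] at oA'
  rw [f'.dist_right_sq, d1] at oB'
  rw [f'.dist_sq, ← hS, ← hQ] at oK'
  have hσ : ⟪u, C - A⟫ = ⟪u', C' - A'⟫ := mul_left_cancel₀ hL.ne' (by linarith)
  rw [← hσ] at oA' oB' oK'
  have hh : ⟪N, C - A⟫ = ⟪N', C' - A'⟫ := mul_left_cancel₀ f.pos.ne' (by linarith)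
  rw [← hh] at oA'
  exact ⟨hh.symm, by linarith⟩

/-- A point `x` opposite to `K` has a negative second coordinate. -/
lemma IsSideFrame.inner_neg_of_sOppSide {A B K u N x : Plane} (f : IsSideFrame A B K u N)
    (h : (line[ℝ, A, B]).SOppSide K x) : ⟪N, x - A⟫ < 0 := by
  obtain ⟨p, hp, ⟨t, ht, rfl⟩, hK, hx⟩ := h.exists_sbtw
  obtain ⟨c, hc⟩ := mem_affineSpan_pair_iff_exists_lineMap_eq.1 hp
  have hp0 : ⟪N, AffineMap.lineMap K x t - A⟫ = 0 := by
    rw [← hc, AffineMap.lineMap_apply, vsub_eq_sub, vadd_eq_add, add_sub_cancel_right,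
      inner_smul_right, f.inner_sub_right, mul_zero]
  have e : AffineMap.lineMap K x t - A = (1 - t) • (K - A) + t • (x - A) := by
    rw [AffineMap.lineMap_apply_module]; module
  rw [e, inner_add_right, inner_smul_right, inner_smul_right] at hp0
  have ht0 : 0 < t := lt_of_le_of_ne ht.1 fun h0 => hK (by rw [← h0]; simp)
  have ht1 : t < 1 := lt_of_le_of_ne ht.2 fun h1 => hx (by rw [h1]; simp)
  have := mul_pos (sub_pos.2 ht1) f.pos
  by_contra hn
  have := mul_nonneg ht0.le (not_lt.1 hn)
  linarith

/-- The local Delaunay condition for two abutting triangles, the second one drawn elsewhere as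
`A' B' K'`, holds if the angles of the two face-circles with the common side add up to at most `π`:
the power of `x` with respect to the first face-circle exceeds the power with respect to the second
one by twice the product of the distance of `x` from the side and the distance between the
centers. -/
lemma delaunay_of_add_le_pi {A B K C u N A' B' K' C' u' N' x : Plane} {R R' a b c α α' : ℝ}
    (f : IsSideFrame A B K u N) (f' : IsSideFrame A' B' K' u' N') (hAB : A ≠ B)
    (d1 : dist A' B' = dist A B) (d2 : dist K' A' = dist A x) (d3 : dist K' B' = dist B x)
    (oA : dist C A ^ 2 = R ^ 2 + a ^ 2) (oB : dist C B ^ 2 = R ^ 2 + b ^ 2)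
    (oA' : dist C' A' ^ 2 = R' ^ 2 + a ^ 2)
    (oB' : dist C' B' ^ 2 = R' ^ 2 + b ^ 2) (oK' : dist C' K' ^ 2 = R' ^ 2 + c ^ 2)
    (hR : 0 < R) (hR' : 0 < R') (hh : ⟪N, C - A⟫ = R * cos α) (hh' : ⟪N', C' - A'⟫ = R' * cos α')
    (hα : 0 < α) (hα' : 0 < α') (hle : α + α' ≤ π) (hx : (line[ℝ, A, B]).SOppSide K x) :
    R ^ 2 + c ^ 2 ≤ dist C x ^ 2 := by
  have hL : 0 < dist A B := dist_pos.2 hAB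
  have hY := f.inner_neg_of_sOppSide hx
  have k1 := f.dist_left_sq x
  have k2 := f.dist_right_sq x
  have k1' := f'.dist_left_sq K'
  have k2' := f'.dist_right_sq K'
  rw [d2, dist_comm A x, k1] at k1'
  rw [d3, d1, dist_comm B x, k2] at k2'
  obtain ⟨hS, hQ⟩ := coord_eq_of_dist_eq (S := ⟪u, x - A⟫) (Q := -⟪N, x - A⟫)
    (S' := ⟪u', K' - A'⟫) hL (by linarith) f'.pos
    (by rw [neg_sq]; exact k1') (by rw [neg_sq]; exact k2')
  rw [f.dist_left_sq] at oA
  rw [f.dist_right_sq] at oB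
  rw [f'.dist_left_sq] at oA'
  rw [f'.dist_right_sq, d1] at oB'
  rw [f'.dist_sq, ← hS, ← hQ] at oK'
  have hσ : ⟪u, C - A⟫ = ⟪u', C' - A'⟫ := mul_left_cancel₀ hL.ne' (by linarith)
  rw [← hσ, hh'] at oA' oB' oK'
  rw [hh] at oA oB
  rw [f.dist_sq, hh]
  set σ := ⟪u, C - A⟫
  set X := ⟪u, x - A⟫
  set Y := ⟪N, x - A⟫
  have sα : 0 < sin α := sin_pos_of_pos_of_lt_pi hα (by linarith)
  have sα' : 0 < sin α' := sin_pos_of_pos_of_lt_pi hα' (by linarith)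
  -- both products are half the length of the chord that the side cuts out of the face-circles
  have hm : R * sin α = R' * sin α' := by
    refine (pow_left_inj₀ (mul_pos hR sα).le (mul_pos hR' sα').le two_ne_zero).1 ?_
    linear_combination oA' - oA + R ^ 2 * sin_sq_add_cos_sq α - R' ^ 2 * sin_sq_add_cos_sq α'
  have hsum : 0 ≤ R * cos α + R' * cos α' := by
    have h1 : 0 ≤ sin (α + α') := sin_nonneg_of_nonneg_of_le_pi (by linarith) hle
    rw [sin_add] at h1
    have h2 : sin α' * (R * cos α + R' * cos α')
        = R * (sin α * cos α' + cos α * sin α') := by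
      linear_combination (-cos α') * hm
    exact nonneg_of_mul_nonneg_right (h2 ▸ mul_nonneg hR.le h1) sα'
  have := mul_nonneg hsum (by linarith : (0 : ℝ) ≤ -Y)
  linarith

namespace DecoratedTriangle

/-- Decorated triangles with the same side lengths and radii have congruent face-circles. -/
lemma faceCircle_congr (D E : DecoratedTriangle) {s : Equiv.Perm (Fin 3)} {u N u' N' : Plane}
    (f : IsSideFrame (D.pt (s 0)) (D.pt (s 1)) (D.pt (s 2)) u N)
    (f' : IsSideFrame (E.pt (s 0)) (E.pt (s 1)) (E.pt (s 2)) u' N')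
    (hd : ∀ k, dist (D.pt (k + 1)) (D.pt (k + 2)) = dist (E.pt (k + 1)) (E.pt (k + 2)))
    (hr : ∀ k, D.rad k = E.rad k) :
    ⟪N, D.faceCenter - D.pt (s 0)⟫ = ⟪N', E.faceCenter - E.pt (s 0)⟫ ∧ D.faceRad = E.faceRad := by
  have hd' : ∀ i j, dist (D.pt i) (D.pt j) = dist (E.pt i) (E.pt j) := by
    intro i j
    have h0 := hd 0
    have h1 := hd 1
    have h2 := hd 2
    have c := fun i j => dist_comm (D.pt i) (D.pt j)
    have c' := fun i j => dist_comm (E.pt i) (E.pt j)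
    fin_cases i <;> fin_cases j <;> simp at h0 h1 h2 ⊢ <;>
      first | assumption | (rw [c, c']; assumption)
  have hne : E.pt (s 0) ≠ E.pt (s 1) :=
    E.affineIndependent.injective.ne (s.injective.ne (by decide))
  obtain ⟨h1, h2⟩ := _root_.faceCircle_congr f' f hne (hd' _ _) (hd' _ _) (hd' _ _)
    (E.orthogonal _) (E.orthogonal _) (E.orthogonal _) (hr _ ▸ D.orthogonal _)
    (hr _ ▸ D.orthogonal _) (hr _ ▸ D.orthogonal _)
  exact ⟨h1, (pow_left_inj₀ D.faceRad_pos.le E.faceRad_pos.le two_ne_zero).1 h2⟩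

lemma exists_frame (D : DecoratedTriangle) (s : Equiv.Perm (Fin 3)) :
    ∃ u N, IsSideFrame (D.pt (s 0)) (D.pt (s 1)) (D.pt (s 2)) u N := by
  refine exists_sideFrame ?_
  rw [← affineIndependent_iff_not_collinear_of_ne (p := D.pt) (s.injective.ne (by decide))
    (s.injective.ne (by decide)) (s.injective.ne (by decide))]
  exact D.affineIndependent

end DecoratedTriangle

lemma perm_three_cases (s : Equiv.Perm (Fin 3)) :
    (s 0 = s 2 + 1 ∧ s 1 = s 2 + 2) ∨ (s 0 = s 2 + 2 ∧ s 1 = s 2 + 1) := by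
  revert s; decide

lemma HasAngleData.hasSignedDist {pt : Fin 3 → Plane} {C : Plane} {R : ℝ} {a g : Fin 3 → ℝ}
    (H : HasAngleData pt C R a g) (s : Equiv.Perm (Fin 3)) :
    HasSignedDist (pt (s 0)) (pt (s 1)) (pt (s 2)) C (R * cos (a (s 2))) := by
  rcases perm_three_cases s with ⟨h0, h1⟩ | ⟨h0, h1⟩ <;> rw [h0, h1]
  · exact H.side _
  · exact (H.side _).swap

lemma DecoratedTriangle.HasAngles.dist_sq_eq_perm {D : DecoratedTriangle} {a g : Fin 3 → ℝ}
    (h : D.HasAngles a g) (hag : IsTriangleAngles a g) (s : Equiv.Perm (Fin 3)) :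
    dist (D.pt (s 0)) (D.pt (s 1)) ^ 2
      = D.rad (s 0) ^ 2 + D.rad (s 1) ^ 2
        + 2 * D.rad (s 0) * D.rad (s 1) * cosh (sideGrad a g (s 2)) := by
  have := h.dist_sq_eq hag (s 2)
  rcases perm_three_cases s with ⟨h0, h1⟩ | ⟨h0, h1⟩ <;> rw [h0, h1]
  · exact this
  · rw [dist_comm, this]; ring

/-! ### Combinatorics of the gluing -/

namespace Triangulation

variable {T : Type*} (𝒯 : Triangulation T)

lemma vertex_glue_zero (d : T × Equiv.Perm (Fin 3)) :
    𝒯.vertex d.1 (d.2 0) = 𝒯.vertex (𝒯.glue d).1 ((𝒯.glue d).2 0) :=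
  Quot.sound ⟨d, rfl, rfl⟩

lemma vertex_glue_one (d : T × Equiv.Perm (Fin 3)) :
    𝒯.vertex d.1 (d.2 1) = 𝒯.vertex (𝒯.glue d).1 ((𝒯.glue d).2 1) := by
  have := 𝒯.vertex_glue_zero (d.1, d.2 * Equiv.swap 0 1)
  simpa [𝒯.glue_reverse] using this

lemma edge_glue (d : T × Equiv.Perm (Fin 3)) :
    𝒯.edge d.1 (d.2 2) = 𝒯.edge (𝒯.glue d).1 ((𝒯.glue d).2 2) :=
  Quot.sound ⟨d, rfl, rfl⟩

/-- The side underlying a directed side. -/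
def side (d : T × Equiv.Perm (Fin 3)) : T × Fin 3 := (d.1, d.2 2)

lemma side_glue_of_side_eq {d d' : T × Equiv.Perm (Fin 3)} (h : side d = side d') :
    side (𝒯.glue d) = side (𝒯.glue d') := by
  obtain ⟨t, s⟩ := d
  obtain ⟨t', s'⟩ := d'
  obtain ⟨rfl, h2⟩ := Prod.mk.inj h
  have key : ∀ s s' : Equiv.Perm (Fin 3), s 2 = s' 2 → s = s' ∨ s = s' * Equiv.swap 0 1 := by
    decide
  rcases key s s' h2 with rfl | rfl
  · rfl
  · have := 𝒯.glue_reverse (t, s')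
    simp only at this
    rw [this]
    have h : Equiv.swap (0 : Fin 3) 1 2 = 2 := by decide
    simp [side, h]

lemma side_glue_eq_iff (d d' : T × Equiv.Perm (Fin 3)) :
    side (𝒯.glue d) = side (𝒯.glue d') ↔ side d = side d' :=
  ⟨fun h => by simpa only [𝒯.glue_glue] using 𝒯.side_glue_of_side_eq h, 𝒯.side_glue_of_side_eq⟩

lemma side_glue_eq_iff' (d d' : T × Equiv.Perm (Fin 3)) :
    side (𝒯.glue d) = side d' ↔ side d = side (𝒯.glue d') := by
  rw [← 𝒯.side_glue_eq_iff (𝒯.glue d), 𝒯.glue_glue]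

/-- Every side carries two directions. -/
lemma sum_directed [Fintype T] (f : T → Fin 3 → ℝ) :
    ∑ d : T × Equiv.Perm (Fin 3), f d.1 (d.2 2) = 2 * ∑ t, ∑ k, f t k := by
  rw [Fintype.sum_prod_type, Finset.mul_sum]
  refine Finset.sum_congr rfl fun t _ => ?_
  rw [← Finset.sum_fiberwise_of_maps_to (t := Finset.univ) (g := fun s : Equiv.Perm (Fin 3) => s 2)
    (fun _ _ => Finset.mem_univ _), Finset.mul_sum]
  refine Finset.sum_congr rfl fun k _ => ?_
  rw [Finset.sum_congr rfl (g := fun _ => f t k) fun s hs => by rw [(Finset.mem_filter.1 hs).2],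
    Finset.sum_const, nsmul_eq_mul]
  congr 1
  have : ∀ k : Fin 3, (Finset.univ.filter fun s : Equiv.Perm (Fin 3) => s 2 = k).card = 2 := by
    decide
  exact_mod_cast this k

instance [Finite T] : Finite 𝒯.Vertex := inferInstanceAs (Finite (Quot _))

end Triangulation

/-! ### Variations of coherent angle systems -/

open Classical in
/-- Solutions of the homogeneous linear equations that belong to the equations of a coherent angle
system: the admissible infinitesimal variations. -/
structure IsVariation {T : Type*} [Fintype T] (𝒯 : Triangulation T) (v : AngleSpace T) : Prop where
  corner_sum : ∀ t, v.2 t 0 + v.2 t 1 + v.2 t 2 = 0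
  interior : ∀ d, 𝒯.glue d ≠ d → v.1 d.1 (d.2 2) + v.1 (𝒯.glue d).1 ((𝒯.glue d).2 2) = 0
  boundary : ∀ d, 𝒯.glue d = d → v.1 d.1 (d.2 2) = 0
  vertex_sum : ∀ w, (∑ c : T × Fin 3, if 𝒯.vertex c.1 c.2 = w then v.2 c.1 c.2 else 0) = 0

/-- Twice the directional derivative of `functionalF` at `p` in the direction `v`. -/
noncomputable def variationF {T : Type*} [Fintype T] (p v : AngleSpace T) : ℝ :=
  ∑ t, ∑ k, (cornerGrad (p.1 t) (p.2 t) k * v.2 t k - sideGrad (p.1 t) (p.2 t) k * v.1 t k)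

section

variable {T : Type*} [Fintype T] {𝒯 : Triangulation T} {θ : 𝒯.Edge → ℝ} {Ξ : 𝒯.Vertex → ℝ}
  {p : AngleSpace T}

lemma hasDerivAt_fst {c : ℝ → AngleSpace T} {v : AngleSpace T} {s : ℝ} (h : HasDerivAt c v s)
    (t : T) (k : Fin 3) : HasDerivAt (fun x => (c x).1 t k) (v.1 t k) s :=
  hasDerivAt_pi.1 (hasDerivAt_pi.1 (hasFDerivAt_fst.comp_hasDerivAt s h) t) k

lemma hasDerivAt_snd {c : ℝ → AngleSpace T} {v : AngleSpace T} {s : ℝ} (h : HasDerivAt c v s)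
    (t : T) (k : Fin 3) : HasDerivAt (fun x => (c x).2 t k) (v.2 t k) s :=
  hasDerivAt_pi.1 (hasDerivAt_pi.1 (hasFDerivAt_snd.comp_hasDerivAt s h) t) k

lemma hasDerivAt_functionalF {c : ℝ → AngleSpace T} {v : AngleSpace T} {s : ℝ}
    (h : HasDerivAt c v s) (hc : ∀ t, IsTriangleAngles ((c s).1 t) ((c s).2 t)) :
    HasDerivAt (fun x => functionalF (c x)) ((1 / 2) * variationF (c s) v) s := by
  unfold functionalF variationF
  rw [Finset.mul_sum]
  exact HasDerivAt.fun_sum fun t _ =>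
    hasDerivAt_triangleV (hasDerivAt_fst h t) (hasDerivAt_snd h t) (hc t)

/-- A function with derivative `f'` that is eventually constant has `f' = 0`. -/
lemma HasDerivAt.eq_zero_of_eventually_eq {f : ℝ → ℝ} {f' s C : ℝ} (h : HasDerivAt f f' s)
    (hC : ∀ᶠ x in 𝓝 s, f x = C) : f' = 0 :=
  (h.congr_of_eventuallyEq (f₁ := fun _ => C) (hC.mono fun _ hx => hx.symm)).unique
    (hasDerivAt_const s C)

/-- The velocity of a curve of coherent angle systems is a variation. -/
lemma isVariation_of_hasDerivAt {c : ℝ → AngleSpace T} {v : AngleSpace T} {s : ℝ}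
    (h : HasDerivAt c v s) (hc : ∀ᶠ x in 𝓝 s, c x ∈ coherentAngleSystems 𝒯 θ Ξ) :
    IsVariation 𝒯 v where
  corner_sum t := (((hasDerivAt_snd h t 0).add (hasDerivAt_snd h t 1)).add
    (hasDerivAt_snd h t 2)).eq_zero_of_eventually_eq (hc.mono fun _ hx => (hx.triangle t).corner_sum)
  interior d hd := ((hasDerivAt_fst h _ _).add (hasDerivAt_fst h _ _)).eq_zero_of_eventually_eq
    (hc.mono fun _ hx => hx.interior d hd)
  boundary d hd := (hasDerivAt_fst h _ _).eq_zero_of_eventually_eq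
    (hc.mono fun _ hx => (hx.boundary d hd).2)
  vertex_sum w := by
    classical
    refine HasDerivAt.eq_zero_of_eventually_eq
      (f := fun x => ∑ c' : T × Fin 3, if 𝒯.vertex c'.1 c'.2 = w then (c x).2 c'.1 c'.2 else 0)
      (HasDerivAt.fun_sum fun c' _ => ?_) (hc.mono fun _ hx => ?_) (s := s) (C := Ξ w)
    · split_ifs
      · exact hasDerivAt_snd h _ _
      · exact hasDerivAt_const _ _
    · convert hx.vertex_sum w

lemma eventually_isTriangleAngles {a g : ℝ → Fin 3 → ℝ} {s : ℝ}
    (ha : ∀ k, ContinuousAt (fun x => a x k) s) (hg : ∀ k, ContinuousAt (fun x => g x k) s)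
    (hsum : ∀ x, g x 0 + g x 1 + g x 2 = π) (h : IsTriangleAngles (a s) (g s)) :
    ∀ᶠ x in 𝓝 s, IsTriangleAngles (a x) (g x) := by
  have h1 : ∀ᶠ x in 𝓝 s, ∀ k, 0 < a x k :=
    eventually_all.2 fun k => (ha k).eventually (lt_mem_nhds (h.side_pos k))
  have h2 : ∀ᶠ x in 𝓝 s, ∀ k, 0 < g x k :=
    eventually_all.2 fun k => (hg k).eventually (lt_mem_nhds (h.corner_pos k))
  have h3 : ∀ᶠ x in 𝓝 s, ∀ k, g x k + a x (k + 1) + a x (k + 2) < π :=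
    eventually_all.2 fun k =>
      (((hg k).add (ha (k + 1))).add (ha (k + 2))).eventually (gt_mem_nhds (h.lt_pi k))
  filter_upwards [h1, h2, h3] with x h1 h2 h3 using ⟨h1, h2, hsum x, h3⟩

/-- The coherent angle systems form a relatively open subset of an affine subspace. -/
lemma eventually_add_smul_mem (hp : p ∈ coherentAngleSystems 𝒯 θ Ξ) {v : AngleSpace T}
    (hv : IsVariation 𝒯 v) :
    ∀ᶠ x : ℝ in 𝓝 0, p + x • v ∈ coherentAngleSystems 𝒯 θ Ξ := by
  have ht : ∀ᶠ x : ℝ in 𝓝 0, ∀ t, IsTriangleAngles ((p + x • v).1 t) ((p + x • v).2 t) := by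
    refine eventually_all.2 fun t => eventually_isTriangleAngles
      (a := fun x => (p + x • v).1 t) (g := fun x => (p + x • v).2 t)
      (fun k => by fun_prop) (fun k => by fun_prop) (fun x => ?_)
      (by simpa using hp.triangle t)
    have h1 := (hp.triangle t).corner_sum
    have h2 := hv.corner_sum t
    simp only [Prod.snd_add, Prod.smul_snd, Pi.add_apply, Pi.smul_apply, smul_eq_mul]
    linear_combination h1 + x * h2
  filter_upwards [ht] with x hx
  refine ⟨hx, fun d hd => ?_, fun d hd => ⟨(hp.boundary d hd).1, ?_⟩, fun w => ?_⟩
  · have h1 := hp.interior d hd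
    have h2 := hv.interior d hd
    simp only [Prod.fst_add, Prod.smul_fst, Pi.add_apply, Pi.smul_apply, smul_eq_mul]
    linear_combination h1 + x * h2
  · have h1 := (hp.boundary d hd).2
    have h2 := hv.boundary d hd
    simp only [Prod.fst_add, Prod.smul_fst, Pi.add_apply, Pi.smul_apply, smul_eq_mul]
    linear_combination h1 + x * h2
  · have h1 := hp.vertex_sum w
    have h2 := hv.vertex_sum w
    refine Eq.trans ?_ ((congrArg₂ (fun y z => y + x * z) h1 h2).trans (by ring))
    rw [Finset.mul_sum, ← Finset.sum_add_distrib]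
    refine Finset.sum_congr rfl fun c _ => ?_
    split_ifs <;> simp

/-- Critical points are the points where all directional derivatives along variations vanish. -/
lemma isCritical_iff_variationF (hp : p ∈ coherentAngleSystems 𝒯 θ Ξ) :
    IsCriticalUnderVariationsIn functionalF (coherentAngleSystems 𝒯 θ Ξ) p ↔
      ∀ v, IsVariation 𝒯 v → variationF p v = 0 := by
  constructor
  · rintro ⟨-, h⟩ v hv
    have hd : HasDerivAt (fun x : ℝ => p + x • v) v 0 := by
      simpa using ((hasDerivAt_id (0 : ℝ)).smul_const v).const_add p
    have h1 := h _ (by simp) hd.differentiableAt (eventually_add_smul_mem hp hv)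
    have h2 := hasDerivAt_functionalF hd (by simpa using hp.triangle)
    have := h2.unique h1
    simp only [zero_smul, add_zero] at this
    linarith
  · refine fun h => ⟨hp, fun c c0 hc hA => ?_⟩
    have hd := hc.hasDerivAt
    have := hasDerivAt_functionalF hd (by simpa [c0] using hp.triangle)
    rwa [c0, h _ (isVariation_of_hasDerivAt hd hA), mul_zero] at this

end

/-! ### The Lagrange multiplier conditions -/

section

variable {T : Type*} [Fintype T] {𝒯 : Triangulation T} {p : AngleSpace T}

/-- If the derivative vanishes along all variations, then at the sides it is given by a function of
the edges. -/
lemma sideGrad_glue_of_variationF_eq_zero (h : ∀ v, IsVariation 𝒯 v → variationF p v = 0)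
    (d : T × Equiv.Perm (Fin 3)) :
    sideGrad (p.1 d.1) (p.2 d.1) (d.2 2)
      = sideGrad (p.1 (𝒯.glue d).1) (p.2 (𝒯.glue d).1) ((𝒯.glue d).2 2) := by
  classical
  set v : AngleSpace T := (fun t k =>
    (if (t, k) = Triangulation.side d then 1 else 0)
      - (if (t, k) = Triangulation.side (𝒯.glue d) then 1 else 0), 0) with hv
  have hval : ∀ e : T × Equiv.Perm (Fin 3), v.1 e.1 (e.2 2)
      = (if Triangulation.side e = Triangulation.side d then 1 else 0)
        - (if Triangulation.side e = Triangulation.side (𝒯.glue d) then 1 else 0) := fun e => rfl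
  -- `v` raises the angle at the side of `d` and lowers the one at the side glued to it
  have hvar : IsVariation 𝒯 v := by
    refine ⟨fun t => by simp [hv], fun e _ => ?_, fun e he => ?_, fun w => by simp [hv]⟩
    · simp only [hval, 𝒯.side_glue_eq_iff, 𝒯.side_glue_eq_iff']
      ring
    · rw [hval]
      have := 𝒯.side_glue_eq_iff' e d
      rw [he] at this
      simp only [this, sub_self]
  have h0 := h v hvar
  have hsum : ∀ c : T × Fin 3, ∑ t, ∑ k, sideGrad (p.1 t) (p.2 t) k * (if (t, k) = c then 1 else 0)
      = sideGrad (p.1 c.1) (p.2 c.1) c.2 := by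
    intro c
    rw [← Fintype.sum_prod_type' (f := fun t k =>
      sideGrad (p.1 t) (p.2 t) k * (if (t, k) = c then 1 else 0))]
    simp
  simp only [variationF, hv, Pi.zero_apply, mul_zero, zero_sub, Finset.sum_neg_distrib, mul_sub,
    Finset.sum_sub_distrib, hsum] at h0
  simp only [Triangulation.side] at h0
  linarith

open Classical in
/-- If the derivative vanishes along all variations, then at the corners it is the sum of a function
of the triangles and a function of the vertices: the Lagrange multipliers. -/
lemma exists_cornerGrad_eq_of_variationF_eq_zero
    (h : ∀ v, IsVariation 𝒯 v → variationF p v = 0) :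
    ∃ (μ : T → ℝ) (ψ : 𝒯.Vertex → ℝ),
      ∀ t k, cornerGrad (p.1 t) (p.2 t) k = μ t + ψ (𝒯.vertex t k) := by
  have : Fintype 𝒯.Vertex := Fintype.ofFinite _
  let pr : T × Fin 3 → ((T × Fin 3 → ℝ) →ₗ[ℝ] ℝ) := LinearMap.proj
  let Φ : T ⊕ 𝒯.Vertex → ((T × Fin 3 → ℝ) →ₗ[ℝ] ℝ) := Sum.elim
    (fun t => ∑ k, pr (t, k)) (fun w => ∑ c, if 𝒯.vertex c.1 c.2 = w then pr c else 0)
  let K : (T × Fin 3 → ℝ) →ₗ[ℝ] ℝ := ∑ c, cornerGrad (p.1 c.1) (p.2 c.1) c.2 • pr c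
  have hK : K ∈ Submodule.span ℝ (Set.range Φ) := by
    refine mem_span_of_iInf_ker_le_ker fun x hx => ?_
    rw [Submodule.mem_iInf] at hx
    have hvar : IsVariation 𝒯 ((0, fun t k => x (t, k)) : AngleSpace T) := by
      refine ⟨fun t => ?_, fun e _ => by simp, fun e _ => by simp, fun w => ?_⟩
      · simpa [Φ, pr, Fin.sum_univ_three] using hx (Sum.inl t)
      · have := hx (Sum.inr w)
        simp only [Φ, pr, Sum.elim_inr, LinearMap.mem_ker, LinearMap.sum_apply] at this
        refine Eq.trans ?_ this
        refine Finset.sum_congr rfl fun c _ => ?_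
        split_ifs <;> simp
    have h0 := h _ hvar
    simp only [variationF, Pi.zero_apply, mul_zero, sub_zero] at h0
    simpa [K, pr, Fintype.sum_prod_type] using h0
  obtain ⟨c, hc⟩ := (Submodule.mem_span_range_iff_exists_fun ℝ).1 hK
  refine ⟨fun t => c (Sum.inl t), fun w => c (Sum.inr w), fun t k => ?_⟩
  have e := LinearMap.congr_fun hc (Pi.single (t, k) 1)
  have hpr : ∀ c', pr c' (Pi.single (t, k) 1) = if c' = (t, k) then 1 else 0 := fun c' => by
    simp [pr, Pi.single_apply]
  have hK' : K (Pi.single (t, k) 1) = cornerGrad (p.1 t) (p.2 t) k := by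
    simp [K, hpr]
  have hT : ∀ t', Φ (Sum.inl t') (Pi.single (t, k) 1) = if t' = t then 1 else 0 := fun t' => by
    by_cases ht : t' = t <;> simp [Φ, hpr, ht]
  have hV : ∀ w, Φ (Sum.inr w) (Pi.single (t, k) 1) = if 𝒯.vertex t k = w then 1 else 0 := by
    intro w
    simp only [Φ, Sum.elim_inr, LinearMap.sum_apply]
    rw [Finset.sum_eq_single (t, k)]
    · split_ifs <;> simp [hpr]
    · intro c' _ hc'
      split_ifs <;> simp [hpr, hc']
    · simp
  rw [hK'] at e
  rw [← e]
  simp [Fintype.sum_sum_type, hT, hV]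

/-- The Lagrange multiplier conditions are sufficient for the derivative to vanish. -/
lemma variationF_eq_zero {μ : T → ℝ} {ψ : 𝒯.Vertex → ℝ}
    (hc : ∀ t k, cornerGrad (p.1 t) (p.2 t) k = μ t + ψ (𝒯.vertex t k))
    (hs : ∀ d, 𝒯.glue d ≠ d → sideGrad (p.1 d.1) (p.2 d.1) (d.2 2)
      = sideGrad (p.1 (𝒯.glue d).1) (p.2 (𝒯.glue d).1) ((𝒯.glue d).2 2))
    {v : AngleSpace T} (hv : IsVariation 𝒯 v) : variationF p v = 0 := by
  classical
  have : Fintype 𝒯.Vertex := Fintype.ofFinite _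
  have h1 : ∑ t, ∑ k, μ t * v.2 t k = 0 := by
    refine Finset.sum_eq_zero fun t _ => ?_
    rw [← Finset.mul_sum, Fin.sum_univ_three, hv.corner_sum, mul_zero]
  have h2 : ∑ t, ∑ k, ψ (𝒯.vertex t k) * v.2 t k = 0 := by
    rw [← Fintype.sum_prod_type' (f := fun t k => ψ (𝒯.vertex t k) * v.2 t k)]
    have : ∀ c : T × Fin 3, ψ (𝒯.vertex c.1 c.2) * v.2 c.1 c.2
        = ∑ w, ψ w * if 𝒯.vertex c.1 c.2 = w then v.2 c.1 c.2 else 0 := fun c => by simp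
    simp only [this]
    rw [Finset.sum_comm]
    refine Finset.sum_eq_zero fun w _ => ?_
    rw [← Finset.mul_sum]
    have := hv.vertex_sum w
    convert mul_zero (ψ w)
  have h3 : ∑ t, ∑ k, sideGrad (p.1 t) (p.2 t) k * v.1 t k = 0 := by
    set f : T → Fin 3 → ℝ := fun t k => sideGrad (p.1 t) (p.2 t) k * v.1 t k with hf
    have e1 := Triangulation.sum_directed f
    have e2 : ∑ d : T × Equiv.Perm (Fin 3), f (𝒯.glue d).1 ((𝒯.glue d).2 2)
        = ∑ d : T × Equiv.Perm (Fin 3), f d.1 (d.2 2) :=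
      Equiv.sum_comp (Equiv.mk 𝒯.glue 𝒯.glue 𝒯.glue_glue 𝒯.glue_glue)
        (fun d => f d.1 (d.2 2))
    have e3 : ∑ d : T × Equiv.Perm (Fin 3),
        (f d.1 (d.2 2) + f (𝒯.glue d).1 ((𝒯.glue d).2 2)) = 0 := by
      refine Finset.sum_eq_zero fun d _ => ?_
      by_cases hd : 𝒯.glue d = d
      · simp [hd, hf, hv.boundary d hd]
      · simp only [hf]
        rw [← hs d hd, ← mul_add, hv.interior d hd, mul_zero]
    rw [Finset.sum_add_distrib, e2] at e3
    linarith
  simp only [variationF, hc, add_mul, Finset.sum_sub_distrib, Finset.sum_add_distrib, h1, h2, h3]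
  ring

end

/-! ### Fitting together -/

section

variable {T : Type*} [Fintype T] {𝒯 : Triangulation T} {θ : 𝒯.Edge → ℝ} {Ξ : 𝒯.Vertex → ℝ}
  {p : AngleSpace T}

/-- In a circle pattern, the logarithms of the radii of the face-circles and vertex-circles are
Lagrange multipliers. -/
lemma variationF_eq_zero_of_fit (hp : p ∈ coherentAngleSystems 𝒯 θ Ξ)
    (h : DecoratedTrianglesFit 𝒯 p) {v : AngleSpace T} (hv : IsVariation 𝒯 v) :
    variationF p v = 0 := by
  obtain ⟨l, r, hpat, hD⟩ := h
  choose D hdraw hang using hD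
  have hrad : ∀ t k, (D t).rad k = r (𝒯.vertex t k) := fun t k => (hdraw t k).2
  refine variationF_eq_zero (𝒯 := 𝒯) (μ := fun t => -log (D t).faceRad) (ψ := fun w => log (r w))
    (fun t k => ?_) (fun d _ => ?_) hv
  · rw [← hrad, (hang t).rad_eq (hp.triangle t), log_mul (D t).faceRad_pos.ne' (exp_pos _).ne',
      log_exp]
    ring
  · have hlen : ∀ d : T × Equiv.Perm (Fin 3),
        dist ((D d.1).pt (d.2 0)) ((D d.1).pt (d.2 1)) = l (𝒯.edge d.1 (d.2 2)) := by
      intro d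
      rw [← (hdraw d.1 (d.2 2)).1]
      rcases perm_three_cases d.2 with ⟨h0, h1⟩ | ⟨h0, h1⟩ <;> rw [h0, h1]
      exact dist_comm _ _
    have e1 := (hang d.1).dist_sq_eq_perm (hp.triangle d.1) d.2
    have e2 := (hang (𝒯.glue d).1).dist_sq_eq_perm (hp.triangle (𝒯.glue d).1) (𝒯.glue d).2
    rw [hlen, hrad, hrad] at e1 e2
    rw [← 𝒯.edge_glue, ← 𝒯.vertex_glue_zero, ← 𝒯.vertex_glue_one, e1] at e2
    have r0 := hpat.rad_pos (𝒯.vertex d.1 (d.2 0))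
    have r1 := hpat.rad_pos (𝒯.vertex d.1 (d.2 1))
    have hpos : 0 < 2 * r (𝒯.vertex d.1 (d.2 0)) * r (𝒯.vertex d.1 (d.2 1)) := by positivity
    exact cosh_injOn (sideGrad_pos (hp.triangle _) _).le (sideGrad_pos (hp.triangle _) _).le
      (mul_left_cancel₀ hpos.ne' (add_left_cancel e2))

/-- From the Lagrange multipliers one reads off the radii of a circle pattern. -/
lemma fit_of_multipliers (hθ : ∀ e, θ e ∈ Set.Ico 0 π) (hp : p ∈ coherentAngleSystems 𝒯 θ Ξ)
    {μ : T → ℝ} {ψ : 𝒯.Vertex → ℝ}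
    (hc : ∀ t k, cornerGrad (p.1 t) (p.2 t) k = μ t + ψ (𝒯.vertex t k))
    (hs : ∀ d, sideGrad (p.1 d.1) (p.2 d.1) (d.2 2)
      = sideGrad (p.1 (𝒯.glue d).1) (p.2 (𝒯.glue d).1) ((𝒯.glue d).2 2)) :
    DecoratedTrianglesFit 𝒯 p := by
  have hex := fun t => exists_decoratedTriangle (hp.triangle t) (exp_pos (-μ t))
  choose D hface hang using hex
  have hrad : ∀ t k, (D t).rad k = exp (ψ (𝒯.vertex t k)) := fun t k => by
    rw [(hang t).rad_eq (hp.triangle t), hface, hc, ← exp_add, neg_add_cancel_left]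
  have hglue : ∀ d : T × Equiv.Perm (Fin 3), dist ((D d.1).pt (d.2 0)) ((D d.1).pt (d.2 1))
      = dist ((D (𝒯.glue d).1).pt ((𝒯.glue d).2 0)) ((D (𝒯.glue d).1).pt ((𝒯.glue d).2 1)) := by
    intro d
    refine (pow_left_inj₀ dist_nonneg dist_nonneg two_ne_zero).1 ?_
    rw [(hang _).dist_sq_eq_perm (hp.triangle _), (hang _).dist_sq_eq_perm (hp.triangle _),
      hrad, hrad, hrad, hrad, hs, 𝒯.vertex_glue_zero, 𝒯.vertex_glue_one]
  have hside : ∀ d : T × Equiv.Perm (Fin 3), dist ((D d.1).pt (d.2 0)) ((D d.1).pt (d.2 1))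
      = dist ((D d.1).pt (d.2 2 + 1)) ((D d.1).pt (d.2 2 + 2)) := by
    intro d
    rcases perm_three_cases d.2 with ⟨h0, h1⟩ | ⟨h0, h1⟩ <;> rw [h0, h1]
    exact dist_comm _ _
  let l : 𝒯.Edge → ℝ := Quot.lift (fun c => dist ((D c.1).pt (c.2 + 1)) ((D c.1).pt (c.2 + 2))) (by
    rintro _ _ ⟨d, rfl, rfl⟩
    rw [← hside, hglue, hside])
  have hl : ∀ t k, l (𝒯.edge t k) = dist ((D t).pt (k + 1)) ((D t).pt (k + 2)) := fun _ _ => rfl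
  have hl' : ∀ t (i j k : Fin 3), i ≠ j → j ≠ k → i ≠ k →
      dist ((D t).pt i) ((D t).pt j) = l (𝒯.edge t k) := by
    intro t i j k hij hjk hik
    have : (i = k + 1 ∧ j = k + 2) ∨ (i = k + 2 ∧ j = k + 1) := by
      revert i j k; decide
    rcases this with ⟨rfl, rfl⟩ | ⟨rfl, rfl⟩
    · rw [hl]
    · rw [hl, dist_comm]
  refine ⟨l, fun w => exp (ψ w), ⟨?_, fun t k => ?_, fun w => exp_pos _, fun t k => ?_, ?_⟩,
    fun t => ⟨D t, fun k => ⟨rfl, hrad t k⟩, hang t⟩⟩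
  · rintro ⟨t, k⟩
    exact dist_pos.2 ((D t).pt_ne k)
  · rw [hl, hl, hl, fin3_add_one_add_one, fin3_add_one_add_two, fin3_add_two_add_one,
      fin3_add_two_add_two]
    rw [add_comm (dist _ _), dist_comm ((D t).pt (k + 2)), dist_comm ((D t).pt k) ((D t).pt (k + 1)),
      dist_lt_dist_add_dist_iff]
    intro hw
    have := (D t).not_collinear (k + 1)
    rw [fin3_add_one_add_one, fin3_add_one_add_two, Set.pair_comm] at this
    exact this hw.collinear
  · rw [← hrad, ← hrad, hl]
    exact (D t).disjoint _ _ (by revert k; decide)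
  · intro d hd E hE x hx0 hx1 hopp
    obtain ⟨u, N, f⟩ := E.exists_frame d.2
    obtain ⟨u₁, N₁, f₁⟩ := (D d.1).exists_frame d.2
    obtain ⟨u₂, N₂, f₂⟩ := (D (𝒯.glue d).1).exists_frame (𝒯.glue d).2
    obtain ⟨hh, hR⟩ := E.faceCircle_congr (D d.1) f f₁
      (fun k => by rw [(hE k).1, hl]) (fun k => by rw [(hE k).2, hrad])
    rw [(hang d.1).hasAngleData.hasSignedDist d.2 _ _ f₁, ← hR] at hh
    have hh₂ := (hang (𝒯.glue d).1).hasAngleData.hasSignedDist (𝒯.glue d).2 _ _ f₂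
    have hint := hp.interior d hd
    have hθe := (hθ (𝒯.edge d.1 (d.2 2))).1
    have hne : ∀ (s : Equiv.Perm (Fin 3)) {i j : Fin 3}, i ≠ j → s i ≠ s j :=
      fun s _ _ h => s.injective.ne h
    have hlen : dist (E.pt (d.2 0)) (E.pt (d.2 1)) = l (𝒯.edge d.1 (d.2 2)) := by
      rw [← (hE (d.2 2)).1]
      rcases perm_three_cases d.2 with ⟨h0, h1⟩ | ⟨h0, h1⟩ <;> rw [h0, h1]
      exact dist_comm _ _
    refine delaunay_of_add_le_pi (a := exp (ψ (𝒯.vertex d.1 (d.2 0))))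
      (b := exp (ψ (𝒯.vertex d.1 (d.2 1)))) (R' := (D (𝒯.glue d).1).faceRad) f f₂
      (E.affineIndependent.injective.ne (hne _ (by decide))) ?_ ?_ ?_ ?_ ?_ ?_ ?_ ?_
      E.faceRad_pos (D _).faceRad_pos hh hh₂
      ((hp.triangle _).side_pos _) ((hp.triangle _).side_pos _) (by linarith) hopp
    · rw [← hglue, hlen, hl' d.1 _ _ (d.2 2)] <;> exact hne _ (by decide)
    · rw [hx0]
      apply hl' <;> exact hne _ (by decide)
    · rw [hx1]
      apply hl' <;> exact hne _ (by decide)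
    · rw [E.orthogonal, (hE _).2]
    · rw [E.orthogonal, (hE _).2]
    · rw [(D _).orthogonal, hrad, ← 𝒯.vertex_glue_zero]
    · rw [(D _).orthogonal, hrad, ← 𝒯.vertex_glue_one]
    · rw [(D _).orthogonal, hrad]

end

theorem lemma3p1 {T : Type*} [Fintype T] (𝒯 : Triangulation T)
    (θ : 𝒯.Edge → ℝ) (hθ : ∀ e, θ e ∈ Set.Ico 0 π)
    (Ξ : 𝒯.Vertex → ℝ) (hΞ : ∀ v, 0 < Ξ v)
    (p : AngleSpace T) (hp : p ∈ coherentAngleSystems 𝒯 θ Ξ) :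
    IsCriticalUnderVariationsIn functionalF (coherentAngleSystems 𝒯 θ Ξ) p ↔
      DecoratedTrianglesFit 𝒯 p := by
  rw [isCritical_iff_variationF hp]
  constructor
  · intro h
    obtain ⟨μ, ψ, hc⟩ := exists_cornerGrad_eq_of_variationF_eq_zero h
    exact fit_of_multipliers hθ hp hc (sideGrad_glue_of_variationF_eq_zero h)
  · exact fun h v hv => variationF_eq_zero_of_fit hp h hv
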